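/- **Setting.** A *quantum algorithm* $\mathcal A$ applies a unitary operator (also denoted $\mathcal A$) to $|0^n\rangle$, measures the last $k\le n$ qubits in the computational basis, and on outcome $x\in\{0,1\}^k$ outputs $v(\mathcal A)=\phi(x)$, for a function $\phi:\{0,1\}^k\to\mathbb R$; $\mathcal D_{\mathcal A}$ is the distribution of $v(\mathcal A)$. For $f:\mathbb R\to\mathbb R$, $f(\mathcal A)$ is the algorithm with $\phi$ replaced by $f\circ\phi$; $\mathcal A_{p,q}$ outputs $v(\mathcal A)$ if $p\le v(\mathcal A)<q$ and $0$ otherwise, and similarly $\mathcal A_{<0}$, $\mathcal A_{\ge0}$. Distributions are compared in total variation distance $\|\mathcal D-\mathcal D'\|=\frac12\sum_x|\mathcal D(x)-\mathcal D'(x)|$. *Amplitude estimation* with parameter $t\ge1$, for a unit vector $|\psi\rangle$ and a projector $P$, with $U=2|\psi\rangle\langle\psi|-I$ and $V=I-2P$: prepare $\frac1{\sqrt t}\sum_{y=0}^{t-1}|\psi\rangle|y\rangle$, apply $|s\rangle|y\rangle\mapsto (UV)^y|s\rangle|y\rangle$, apply the inverse quantum Fourier transform on $\mathbb C^t$ to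 the second register, measure that register, and on outcome $j$ output $\sin^2(\pi j/t)$. It is counted as $t$ uses of $U$. *Algorithm 1* ($0\le v(\mathcal A)\le1$; parameters $t$, $\delta$): with $W|x\rangle|0\rangle=|x\rangle(\sqrt{1-\phi(x)}|0\rangle+\sqrt{\phi(x)}|1\rangle)$, $|\psi\rangle=(I\otimes W)(\mathcal A\otimes I)|0^{n+1}\rangle$ and $P=I\otimes|1\rangle\langle1|$, output the median of $2\lceil K\ln(1/\delta)\rceil+1$ independent runs of amplitude estimation with parameter $t$. *Algorithm 2* ($v(\mathcal A)\ge0$; accuracy $\epsilon<1/2$): let $k=\lceil\log_2(1/\epsilon)\rceil$ and $t_0=\lceil D\sqrt{\log_2(1/\epsilon)}/\epsilon\rceil$. Run Algorithm 1 with $t=t_0$, $\delta=1/10$ to get an estimate $\widetilde\mu_0$ of $\mathbb E[v(\mathcal A_{0,1})]$ and, for $\ell=1,\dots,k$, with $t=t_0$, $\delta=1/(10k)$ to get an estimate $\widetilde\mu_\ell$ of $\mathbb E[v(\mathcal A_{2^{\ell-1},2^\ell})/2^\ell]$. Output $\widetilde\mu_0+\sum_{\ell=1}^k2^\ell\widetilde\mu_\ell$.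 *Algorithm 3* (parameters $\sigma$ and $0<\epsilon<4\sigma$): run $\mathcal A'=\mathcal A/\sigma$ once, with output $\widetilde m$; let $\mathcal C$ be $\mathcal A'$ with $\widetilde m$ subtracted from its output. For each of $-\mathcal C_{<0}/4$ and $\mathcal C_{\ge0}/4$, take the median of $2\lceil K'\ln 9\rceil+1$ independent runs of Algorithm 2 with accuracy $\epsilon/(32\sigma)$ (that is, failure probability $1/9$); call the results $\widetilde\mu^-$, $\widetilde\mu^+$. Output $\sigma(\widetilde m-4\widetilde\mu^-+4\widetilde\mu^+)$. **Lemma.** The following holds for all sufficiently large universal constants $D,K,K'$ (that is, whenever each is at least some absolute constant). Let $\mathcal A$ and $\mathcal B$ be quantum algorithms with $\|\mathcal D_{\mathcal A}-\mathcal D_{\mathcal B}\|\le\gamma$, let $0<\epsilon<4\sigma$, and assume $\operatorname{Var}(v(\mathcal B))\le\sigma^2$. Suppose that Algorithm 3 with parameters $\sigma,\epsilon$ is applied to $\mathcal A$ and uses $U$ (at most) $T$ times in total. Then its output $\widetilde\mu$ satisfies $$|\widetilde\mu-\mathbb E[v(\mathcal B)]|\le\epsilon\quad\text{except with probability at most}\quad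 \frac3{10}+\frac{\pi^2}{\sqrt6}\,T\sqrt\gamma .$$ -/

import Mathlib

open scoped Kronecker Matrix

noncomputable section

namespace QMC

/-! ### Pure states and measurements -/

/-- A (normalised) pure state with amplitudes indexed by the computational basis `ι`. -/
def IsState {ι : Type} [Fintype ι] (s : ι → ℂ) : Prop := ∑ i, ‖s i‖ ^ 2 = 1

/-- The basis state `|i⟩`. -/
def ket {ι : Type} [DecidableEq ι] (i : ι) : ι → ℂ := Pi.single i 1

/-- Born rule: the distribution of the outcome of a measurement of `s` in the computational basis.
Measuring only some of the registers is the corresponding marginal (`PMF.map`). -/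
def born {ι : Type} [Fintype ι] (s : ι → ℂ) (hs : IsState s) : PMF ι :=
  PMF.ofFintype (fun i => ENNReal.ofReal (‖s i‖ ^ 2)) (by
    rw [← ENNReal.ofReal_sum_of_nonneg (fun i _ => by positivity), hs, ENNReal.ofReal_one])

lemma sum_norm_sq_eq {ι : Type} [Fintype ι] (s : ι → ℂ) :
    ((∑ i, ‖s i‖ ^ 2 : ℝ) : ℂ) = star s ⬝ᵥ s := by
  simp [dotProduct, ← Complex.normSq_eq_conj_mul_self, Complex.normSq_eq_norm_sq]

lemma isState_iff {ι : Type} [Fintype ι] (s : ι → ℂ) : IsState s ↔ star s ⬝ᵥ s = 1 := by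
  rw [← sum_norm_sq_eq, IsState]
  norm_cast

lemma isState_ket {ι : Type} [Fintype ι] [DecidableEq ι] (i : ι) : IsState (ket i) := by
  rw [isState_iff]
  simp [ket]

lemma IsState.mulVec {ι : Type} [Fintype ι] [DecidableEq ι] {s : ι → ℂ} (hs : IsState s)
    {M : Matrix ι ι ℂ} (hM : M ∈ Matrix.unitaryGroup ι ℂ) : IsState (M *ᵥ s) := by
  rw [isState_iff] at hs ⊢
  rw [Matrix.star_mulVec, Matrix.dotProduct_mulVec, Matrix.vecMul_vecMul,
    ← Matrix.star_eq_conjTranspose, Matrix.mem_unitaryGroup_iff'.1 hM, Matrix.vecMul_one, hs]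

/-! ### Procedures: random outputs together with the number of uses of `U` -/

/-- A procedure returning a value of type `α`: the joint distribution of the returned value and of
the number of uses of the reflection `U` made in the run. -/
structure Proc (α : Type) where
  law : PMF (α × ℕ)

/-- Sequential composition: outputs are passed on, the numbers of uses of `U` add up. -/
instance : Monad Proc where
  pure a := ⟨PMF.pure (a, 0)⟩
  bind p f := ⟨p.law.bind fun a => (f a.1).law.map fun b => (b.1, a.2 + b.2)⟩

/-- Every run of the procedure uses `U` at most `T` times. -/
def Proc.UsesAtMost {α : Type} (p : Proc α) (T : ℕ) : Prop :=
  ∀ z ∈ p.law.support, z.2 ≤ T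

/-- The probability that the returned value lies in `s`. -/
def Proc.prob {α : Type} (p : Proc α) (s : Set α) : ENNReal :=
  p.law.toOuterMeasure {z | z.1 ∈ s}

/-- `n` independent runs of `p`, with the list of results. -/
def Proc.runs (p : Proc ℝ) : ℕ → Proc (List ℝ)
  | 0 => pure []
  | n + 1 => do
    let a ← p
    let l ← Proc.runs p n
    pure (a :: l)

/-- The median of a list of odd length: the middle entry of the sorted list. -/
def median (l : List ℝ) : ℝ :=
  (l.mergeSort (fun a b => decide (a ≤ b))).getD (l.length / 2) 0

/-- The number of repetitions for failure probability `δ`: an odd number that is `O(log (1/δ))`,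
with `K` the constant in the `O`. -/
def reps (K δ : ℝ) : ℕ := 2 * ⌈K * Real.log (1 / δ)⌉₊ + 1

/-- The median of `O(log (1/δ))` independent runs. -/
def Proc.power (p : Proc ℝ) (K δ : ℝ) : Proc ℝ := do
  let l ← p.runs (reps K δ)
  pure (median l)

/-! ### Amplitude estimation -/

/-- The quantum Fourier transform on `ℂ^t`. -/
def qft (t : ℕ) : Matrix (Fin t) (Fin t) ℂ :=
  Matrix.of fun x y =>
    Complex.exp (2 * Real.pi * Complex.I * ((x : ℕ) : ℂ) * ((y : ℕ) : ℂ) / t) / (Real.sqrt t : ℂ)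

/-- The reflection `U = 2|ψ⟩⟨ψ| - I`. -/
def reflU {ι : Type} [DecidableEq ι] (ψ : ι → ℂ) : Matrix ι ι ℂ :=
  2 • Matrix.vecMulVec ψ (star ψ) - 1

/-- `V = I - 2P`. -/
def reflV {ι : Type} [DecidableEq ι] (P : Matrix ι ι ℂ) : Matrix ι ι ℂ := 1 - 2 • P

/-- The final state of the amplitude estimation circuit, on the system register and a phase register
with basis `|0⟩, …, |t-1⟩`: from `|ψ⟩|0⟩`, apply the Fourier transform to the phase register, then
`|s⟩|y⟩ ↦ (UV)^y |s⟩|y⟩`, then the inverse Fourier transform to the phase register. -/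
def ampEstState {ι : Type} [Fintype ι] [DecidableEq ι] (ψ : ι → ℂ) (P : Matrix ι ι ℂ) (t : ℕ+) :
    ι × Fin t → ℂ :=
  (((1 : Matrix ι ι ℂ) ⊗ₖ (qft t)ᴴ) *
    Matrix.blockDiagonal (fun y : Fin t => (reflU ψ * reflV P) ^ (y : ℕ)) *
    ((1 : Matrix ι ι ℂ) ⊗ₖ qft t)) *ᵥ (fun z => ψ z.1 * ket (0 : Fin t) z.2)

lemma qft_mem (t : ℕ+) : qft t ∈ Matrix.unitaryGroup (Fin t) ℂ := by
  have ht : (0 : ℝ) < (t : ℕ) := by exact_mod_cast t.pos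
  have htc : ((t : ℕ) : ℂ) ≠ 0 := by exact_mod_cast t.pos.ne'
  have hsq : ((Real.sqrt ((t : ℕ) : ℝ) : ℂ)) * (Real.sqrt ((t : ℕ) : ℝ) : ℂ) = ((t : ℕ) : ℂ) := by
    rw [← Complex.ofReal_mul, Real.mul_self_sqrt ht.le, Complex.ofReal_natCast]
  have key : ∀ x y z : Fin t, (star (qft t)) x y * qft t y z =
      (Complex.exp (2 * Real.pi * Complex.I * (((z : ℕ) : ℂ) - ((x : ℕ) : ℂ)) / (t : ℕ))) ^ (y : ℕ)
        / (t : ℕ) := by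
    intro x y z
    rw [Matrix.star_apply, ← Complex.exp_nat_mul]
    simp only [qft, Matrix.of_apply, star_div₀, RCLike.star_def, Complex.conj_ofReal,
      ← Complex.exp_conj]
    rw [div_mul_div_comm, hsq, ← Complex.exp_add]
    congr 2
    simp only [map_div₀, map_mul, Complex.conj_ofReal, Complex.conj_I, map_natCast, map_ofNat]
    field_simp
    ring
  rw [Matrix.mem_unitaryGroup_iff']
  ext x z
  rw [Matrix.mul_apply]
  simp only [key]
  rw [← Finset.sum_div, Fin.sum_univ_eq_sum_range (fun n => Complex.exp (2 * Real.pi * Complex.I *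
    (((z : ℕ) : ℂ) - ((x : ℕ) : ℂ)) / (t : ℕ)) ^ n) (t : ℕ)]
  by_cases hxz : x = z
  · subst hxz
    simp [htc]
  · rw [Matrix.one_apply_ne hxz]
    have h1 : Complex.exp (2 * Real.pi * Complex.I *
        (((z : ℕ) : ℂ) - ((x : ℕ) : ℂ)) / (t : ℕ)) ≠ 1 := by
      intro h
      obtain ⟨n, hn⟩ := Complex.exp_eq_one_iff.1 h
      have h2 : (((z : ℕ) : ℂ) - ((x : ℕ) : ℂ)) = n * (t : ℕ) := by
        have := Complex.two_pi_I_ne_zero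
        field_simp at hn
        rw [hn, mul_comm]
      have h3 : ((z : ℕ) : ℤ) - ((x : ℕ) : ℤ) = n * (t : ℕ) := by exact_mod_cast h2
      have hx := x.2
      have hz := z.2
      have h4 : n = 0 := by
        by_contra hne
        rcases lt_or_gt_of_ne hne with h | h <;> nlinarith
      subst h4
      exact hxz (Fin.ext (by omega))
    rw [geom_sum_eq h1, ← Complex.exp_nat_mul]
    have h5 : ((t : ℕ) : ℂ) * (2 * Real.pi * Complex.I *
        (((z : ℕ) : ℂ) - ((x : ℕ) : ℂ)) / (t : ℕ)) =
        (((z : ℕ) : ℤ) - ((x : ℕ) : ℤ) : ℤ) * (2 * Real.pi * Complex.I) := by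
      push_cast
      field_simp
    rw [h5, Complex.exp_int_mul_two_pi_mul_I]
    simp

lemma reflU_mem {ι : Type} [Fintype ι] [DecidableEq ι] {ψ : ι → ℂ} (hψ : IsState ψ) :
    reflU ψ ∈ Matrix.unitaryGroup ι ℂ := by
  rw [isState_iff] at hψ
  have h1 : star (reflU ψ) = reflU ψ := by
    simp only [reflU, star_sub, star_one, star_nsmul]
    rw [Matrix.star_eq_conjTranspose, Matrix.conjTranspose_vecMulVec, star_star]
  have h2 : Matrix.vecMulVec ψ (star ψ) * Matrix.vecMulVec ψ (star ψ) =
      Matrix.vecMulVec ψ (star ψ) := by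
    rw [Matrix.vecMulVec_mul_vecMulVec, hψ]
    simp
  have h3 : ∀ E : Matrix ι ι ℂ, (2 • E - 1) * (2 • E - 1) = 4 • (E * E) - 4 • E + 1 := by
    intro E
    noncomm_ring
  rw [Matrix.mem_unitaryGroup_iff, h1, reflU, h3, h2]
  simp

lemma reflV_mem {ι : Type} [Fintype ι] [DecidableEq ι] {P : Matrix ι ι ℂ}
    (hP : IsStarProjection P) : reflV P ∈ Matrix.unitaryGroup ι ℂ := by
  have h1 : star (reflV P) = reflV P := by
    simp only [reflV, star_sub, star_one, star_nsmul]
    rw [hP.isSelfAdjoint.star_eq]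
  have h3 : ∀ E : Matrix ι ι ℂ, (1 - 2 • E) * (1 - 2 • E) = 4 • (E * E) - 4 • E + 1 := by
    intro E
    noncomm_ring
  rw [Matrix.mem_unitaryGroup_iff, h1, reflV, h3, hP.isIdempotentElem.eq]
  simp

lemma blockDiagonal_mem {ι κ : Type} [Fintype ι] [DecidableEq ι] [Fintype κ] [DecidableEq κ]
    {M : κ → Matrix ι ι ℂ} (hM : ∀ y, M y ∈ Matrix.unitaryGroup ι ℂ) :
    Matrix.blockDiagonal M ∈ Matrix.unitaryGroup (ι × κ) ℂ := by
  rw [Matrix.mem_unitaryGroup_iff, Matrix.star_eq_conjTranspose,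
    Matrix.blockDiagonal_conjTranspose, ← Matrix.blockDiagonal_mul]
  have h : (fun k => M k * (M k)ᴴ) = 1 := by
    funext k
    exact Matrix.mem_unitaryGroup_iff.1 (hM k)
  rw [h, Matrix.blockDiagonal_one]

lemma kronecker_mem {ι κ : Type} [Fintype ι] [DecidableEq ι] [Fintype κ] [DecidableEq κ]
    {M : Matrix ι ι ℂ} {N : Matrix κ κ ℂ} (hM : M ∈ Matrix.unitaryGroup ι ℂ)
    (hN : N ∈ Matrix.unitaryGroup κ ℂ) : M ⊗ₖ N ∈ Matrix.unitaryGroup (ι × κ) ℂ :=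
  Matrix.kronecker_mem_unitary hM hN

lemma isState_ampEstState {ι : Type} [Fintype ι] [DecidableEq ι] {ψ : ι → ℂ} (hψ : IsState ψ)
    {P : Matrix ι ι ℂ} (hP : IsStarProjection P) (t : ℕ+) : IsState (ampEstState ψ P t) := by
  have h0 : IsState (fun z : ι × Fin t => ψ z.1 * ket (0 : Fin t) z.2) := by
    have h1 := isState_ket (0 : Fin t)
    unfold IsState at hψ h1 ⊢
    simp only [norm_mul, mul_pow, Fintype.sum_prod_type, ← Finset.mul_sum, h1, mul_one, hψ]
  have hF := qft_mem t
  have hF' : (qft t)ᴴ ∈ Matrix.unitaryGroup (Fin t) ℂ := Unitary.star_mem hF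
  exact h0.mulVec (mul_mem (mul_mem (kronecker_mem (one_mem _) hF') (blockDiagonal_mem fun y =>
    pow_mem (mul_mem (reflU_mem hψ) (reflV_mem hP)) _)) (kronecker_mem (one_mem _) hF))

/-- Amplitude estimation with parameter `t`, estimating `⟨ψ|P|ψ⟩`: measure the phase register of
`ampEstState`; on outcome `j`, output `sin² (π j / t)`. It uses `U` (and `V`) `t` times. -/
def ampEst {ι : Type} [Fintype ι] [DecidableEq ι] (ψ : ι → ℂ) (hψ : IsState ψ)
    (P : Matrix ι ι ℂ) (hP : IsStarProjection P) (t : ℕ+) : Proc ℝ :=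
  ⟨(born (ampEstState ψ P t) (isState_ampEstState hψ hP t)).map fun z =>
    (Real.sin (Real.pi * ((z.2 : ℕ) : ℝ) / ((t : ℕ) : ℝ)) ^ 2, (t : ℕ))⟩

/-! ### The algorithms to which mean estimation is applied -/

/-- Computational basis labels of `n` qubits. -/
abbrev Bits (n : ℕ) : Type := Fin n → Bool

/-- The label of `|0^n⟩`. -/
def zeroBits (n : ℕ) : Bits n := fun _ => false

/-- A quantum algorithm: it applies a unitary to `|0^n⟩` with `n = m + k`, measures the last `k`
qubits, and outputs `φ x` on measurement outcome `x`. -/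
structure QAlg where
  m : ℕ
  k : ℕ
  unitary : Matrix.unitaryGroup (Bits m × Bits k) ℂ
  φ : Bits k → ℝ

namespace QAlg

/-- The state before the measurement. -/
def state (A : QAlg) : Bits A.m × Bits A.k → ℂ :=
  (A.unitary : Matrix _ _ ℂ) *ᵥ ket (zeroBits A.m, zeroBits A.k)

lemma isState_state (A : QAlg) : IsState A.state := (isState_ket _).mulVec A.unitary.2

/-- The distribution of the measurement outcome `x`. -/
def outcome (A : QAlg) : PMF (Bits A.k) := PMF.map Prod.snd (born A.state A.isState_state)

/-- The distribution of the output value `v(A)`. -/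
def law (A : QAlg) : PMF ℝ := PMF.map A.φ A.outcome

/-- `E[v(A)]`. -/
def mean (A : QAlg) : ℝ := ∑ x, (A.outcome x).toReal * A.φ x

/-- `Var(v(A))`. -/
def variance (A : QAlg) : ℝ := ∑ x, (A.outcome x).toReal * (A.φ x - A.mean) ^ 2

/-- The algorithm `f(A)` that runs `A` and applies `f` to the output value. -/
def post (A : QAlg) (f : ℝ → ℝ) : QAlg := { A with φ := fun x => f (A.φ x) }

/-- Running `A` once (without using `U`). -/
def run (A : QAlg) : Proc ℝ := ⟨A.law.map fun v => (v, 0)⟩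

/-- The output values lie in `[0,1]`. -/
def Bounded (A : QAlg) : Prop := ∀ x, 0 ≤ A.φ x ∧ A.φ x ≤ 1

end QAlg

/-- Total variation distance of two discrete distributions. -/
def tvDist (p q : PMF ℝ) : ℝ := (1 / 2) * ∑' x, |(p x).toReal - (q x).toReal|

/-! ### Mean estimation for output values in `[0,1]` -/

/-- One-qubit rotation with `|0⟩ ↦ √(1-a)|0⟩ + √a|1⟩`. -/
def rot (a : ℝ) : Matrix Bool Bool ℂ :=
  Matrix.of fun b b' =>
    match b, b' with
    | false, false => (Real.sqrt (1 - a) : ℂ)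
    | true, false => (Real.sqrt a : ℂ)
    | false, true => -(Real.sqrt a : ℂ)
    | true, true => (Real.sqrt (1 - a) : ℂ)

/-- The unitary `W|x⟩|0⟩ = |x⟩(√(1-φ(x))|0⟩ + √φ(x)|1⟩)` on `k + 1` qubits. -/
def rotW {k : ℕ} (φ : Bits k → ℝ) : Matrix (Bits k × Bool) (Bits k × Bool) ℂ :=
  Matrix.of fun p q => if p.1 = q.1 then rot (φ p.1) p.2 q.2 else 0

/-- The state `(I ⊗ W)(A ⊗ I)|0^{n+1}⟩`. -/
def flagState (A : QAlg) : Bits A.m × (Bits A.k × Bool) → ℂ :=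
  (((1 : Matrix (Bits A.m) (Bits A.m) ℂ) ⊗ₖ rotW A.φ) *
    Matrix.reindex (Equiv.prodAssoc _ _ _) (Equiv.prodAssoc _ _ _)
      ((A.unitary : Matrix _ _ ℂ) ⊗ₖ (1 : Matrix Bool Bool ℂ))) *ᵥ
    ket (zeroBits A.m, (zeroBits A.k, false))

/-- The projector `I ⊗ |1⟩⟨1|` on the added qubit. -/
def flagProj (A : QAlg) :
    Matrix (Bits A.m × (Bits A.k × Bool)) (Bits A.m × (Bits A.k × Bool)) ℂ :=
  Matrix.diagonal fun z => if z.2.2 then 1 else 0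

lemma rotW_mem {k : ℕ} {φ : Bits k → ℝ} (hφ : ∀ x, 0 ≤ φ x ∧ φ x ≤ 1) :
    rotW φ ∈ Matrix.unitaryGroup (Bits k × Bool) ℂ := by
  have hr : ∀ x, star (rot (φ x)) * rot (φ x) = 1 := by
    intro x
    have h1 : ((Real.sqrt (φ x) : ℂ)) * (Real.sqrt (φ x) : ℂ) = (φ x : ℂ) := by
      rw [← Complex.ofReal_mul, Real.mul_self_sqrt (hφ x).1]
    have h2 : ((Real.sqrt (1 - φ x) : ℂ)) * (Real.sqrt (1 - φ x) : ℂ) = 1 - (φ x : ℂ) := by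
      rw [← Complex.ofReal_mul, Real.mul_self_sqrt (by linarith [(hφ x).2])]
      push_cast
      ring
    ext b b'
    cases b <;> cases b' <;> simp [Matrix.mul_apply, Matrix.star_apply, rot] <;>
      first | ring1 | linear_combination h1 + h2
  rw [Matrix.mem_unitaryGroup_iff']
  ext ⟨x, b⟩ ⟨y, c⟩
  rw [Matrix.mul_apply, Fintype.sum_prod_type, Finset.sum_eq_single x]
  · by_cases hxy : x = y
    · subst hxy
      have := congrFun (congrFun (hr x) b) c
      rw [Matrix.mul_apply] at this
      simpa [Matrix.star_apply, rotW, Matrix.one_apply] using this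
    · simp [rotW, hxy]
  · intro z _ hz
    simp [rotW, hz, Matrix.star_apply]
  · simp

lemma isState_flagState {A : QAlg} (hA : A.Bounded) : IsState (flagState A) := by
  refine (isState_ket _).mulVec (mul_mem (kronecker_mem (one_mem _) (rotW_mem hA)) ?_)
  have h := kronecker_mem A.unitary.2 (one_mem (Matrix.unitaryGroup Bool ℂ))
  rw [Matrix.mem_unitaryGroup_iff] at h ⊢
  rw [Matrix.star_eq_conjTranspose, Matrix.conjTranspose_reindex, Matrix.reindex_apply,
    Matrix.reindex_apply, Matrix.submatrix_mul_equiv, ← Matrix.star_eq_conjTranspose, h,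
    Matrix.submatrix_one_equiv]

lemma isStarProjection_flagProj (A : QAlg) : IsStarProjection (flagProj A) := by
  refine ⟨?_, ?_⟩
  · rw [IsIdempotentElem, flagProj, Matrix.diagonal_mul_diagonal]
    congr 1
    funext z
    split_ifs <;> simp
  · rw [IsSelfAdjoint, Matrix.star_eq_conjTranspose, flagProj, Matrix.diagonal_conjTranspose]
    congr 1
    funext z
    simp only [Pi.star_apply]
    split_ifs <;> simp

/-- Estimating `E[v(A)]` when `0 ≤ v(A) ≤ 1`: the median of `O(log (1/δ))` runs of amplitude
estimation with parameter `t`. -/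
def meanBounded (K : ℝ) (A : QAlg) (hA : A.Bounded) (t : ℕ+) (δ : ℝ) : Proc ℝ :=
  (ampEst (flagState A) (isState_flagState hA) (flagProj A) (isStarProjection_flagProj A) t).power
    K δ

/-! ### Mean estimation for non-negative output values with bounded `ℓ₂` norm -/

/-- The function `v ↦ v` if `p ≤ v < q`, and `0` otherwise. -/
def trunc (p q v : ℝ) : ℝ := if p ≤ v ∧ v < q then v else 0

lemma bounded_trunc (A : QAlg) : (A.post (trunc 0 1)).Bounded := by
  intro x
  simp only [QAlg.post, trunc]
  split_ifs with h
  · exact ⟨h.1, h.2.le⟩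
  · simp

lemma bounded_level (A : QAlg) (l : ℕ) :
    (A.post fun v => trunc (2 ^ l) (2 ^ (l + 1)) v / 2 ^ (l + 1)).Bounded := by
  intro x
  simp only [QAlg.post, trunc]
  have h2 : (0 : ℝ) < 2 ^ (l + 1) := by positivity
  split_ifs with h
  · have h3 : (0 : ℝ) < 2 ^ l := by positivity
    exact ⟨div_nonneg (h3.le.trans h.1) h2.le, (div_le_one h2).2 h.2.le⟩
  · simp

/-- The sum over `ℓ = 1, …, j` of `2^ℓ` times the estimate of `E[v(A_{2^(ℓ-1), 2^ℓ}) / 2^ℓ]`, each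
estimate being made with parameters `t` and `δ`. -/
def levels (K : ℝ) (A : QAlg) (t : ℕ+) (δ : ℝ) : ℕ → Proc ℝ
  | 0 => pure 0
  | l + 1 => do
    let s ← levels K A t δ l
    let μ ← meanBounded K (A.post fun v => trunc (2 ^ l) (2 ^ (l + 1)) v / 2 ^ (l + 1))
      (bounded_level A l) t δ
    pure (s + 2 ^ (l + 1) * μ)

/-- Estimating `E[v(A)]` for `v(A) ≥ 0` with bounded `ℓ₂` norm and accuracy parameter `ε < 1/2`.
(The ceiling defining `t₀` is positive for `D > 0`; `Nat.toPNat'` leaves it unchanged.) -/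
def meanL2 (D K : ℝ) (A : QAlg) (ε : ℝ) : Proc ℝ := do
  let k : ℕ := ⌈Real.logb 2 (1 / ε)⌉₊
  let t₀ : ℕ+ := ⌈D * Real.sqrt (Real.logb 2 (1 / ε)) / ε⌉₊.toPNat'
  let μ₀ ← meanBounded K (A.post (trunc 0 1)) (bounded_trunc A) t₀ (1 / 10)
  let s ← levels K A t₀ (1 / (10 * k)) k
  pure (μ₀ + s)

/-! ### Mean estimation for output values with bounded variance -/

/-- Estimating `E[v(A)]` for `Var(v(A)) ≤ σ²` and accuracy `ε < 4σ`. `D`, `K`, `K'` are the universal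
constants: `D` in the number of iterations, `K` and `K'` in the numbers of repetitions whose median
is taken inside `meanL2`, and around `meanL2` to reach failure probability `1/9`, respectively. -/
def meanVariance (D K K' : ℝ) (A : QAlg) (σ ε : ℝ) : Proc ℝ := do
  let A' : QAlg := A.post fun v => v / σ
  let m ← A'.run
  let B : QAlg := A'.post fun v => v - m
  let μneg ← (meanL2 D K (B.post fun v => -(if v < 0 then v else 0) / 4) (ε / (32 * σ))).power
    K' (1 / 9)
  let μpos ← (meanL2 D K (B.post fun v => (if 0 ≤ v then v else 0) / 4) (ε / (32 * σ))).power
    K' (1 / 9)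
  pure (σ * (m - 4 * μneg + 4 * μpos))

end QMC

end

open scoped Kronecker Matrix

/-! The bound follows from a comparison of resolutions, without a hybrid argument on the circuit.
Since `π² / √6 ≥ 1`, nothing is to be proved when `T√γ ≥ 1`. Suppose `T√γ < 1`, and let `t` be the
parameter of the amplitude estimations. A single one of them already uses `U` exactly `t` times, so
`t ≤ T` and `t²γ ≤ 1`. Hence the expectations of a `[0,1]`-valued function under `A` and `B` differ
by at most `2γ ≤ 2/t²`. Amplitude estimation of `a` has error of order `√a/t + 1/t²`, so a shift of
the target by `2/t²` only changes the constant (`sqrt_transfer`). Thus every estimate made from `A`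
is as good an estimate of the corresponding mean of `B`, and the usual analysis runs with the
moments of `B` alone, giving failure probability at most `3/10` (`prob_meanVariance_le`).

Three ingredients support that analysis. The outcome law of amplitude estimation is the equal
mixture of the phase estimation laws for `θ` and `-θ` (`sum_norm_sq_ampEstState`); this is read off
from the inner products of the iterates of `UV`, with no diagonalisation. Tails of the Fejér kernel
then give failure probability at most `1/5` (`prob_ampEst_le`), which medians amplify. Finally, a
dyadic decomposition and Cauchy–Schwarz turn a second moment bound into a bound on the total error
(`truncated_error_le`), while Chebyshev's inequality for one sample reduces bounded variance to a
bounded second moment. -/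

namespace QMC

/-! ### Failure probabilities and resource counts of composed procedures -/

namespace Proc

lemma prob_le_one {α : Type} (p : Proc α) (s : Set α) : p.prob s ≤ 1 := by
  rw [prob, PMF.toOuterMeasure_apply]
  calc _ ≤ ∑' z, p.law z := ENNReal.tsum_le_tsum fun z => Set.indicator_le_self _ _ z
    _ = 1 := p.law.tsum_coe

lemma prob_mono {α : Type} (p : Proc α) {s s' : Set α} (h : s ⊆ s') : p.prob s ≤ p.prob s' :=
  MeasureTheory.OuterMeasure.mono _ fun _ hz => h hz

lemma prob_pure {α : Type} {a : α} {s : Set α} (h : a ∉ s) : (pure a : Proc α).prob s = 0 := by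
  change (PMF.pure (a, 0)).toOuterMeasure {z | z.1 ∈ s} = 0
  rw [PMF.toOuterMeasure_pure_apply]
  simp [h]

lemma prob_bind {α β : Type} (p : Proc α) (f : α → Proc β) (s : Set β) :
    (p >>= f).prob s = ∑' a, p.law a * (f a.1).prob s := by
  change (p.law.bind fun a => (f a.1).law.map fun b => (b.1, a.2 + b.2)).toOuterMeasure _ = _
  rw [PMF.toOuterMeasure_bind_apply]
  refine tsum_congr fun a => ?_
  rw [PMF.toOuterMeasure_map_apply]
  rfl

/-- If the result of the first step lies outside `A`, the remaining steps contribute at most `c'`;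
otherwise they contribute at most `c`. -/
lemma prob_bind_le {α β : Type} (p : Proc α) (f : α → Proc β) (s : Set β) (A : Set α)
    {c c' : ENNReal} (h : ∀ a ∈ A, (f a).prob s ≤ c) (h' : ∀ a ∉ A, (f a).prob s ≤ c') :
    (p >>= f).prob s ≤ p.prob A * c + c' := by
  rw [prob_bind, prob, PMF.toOuterMeasure_apply, ← ENNReal.tsum_mul_right]
  calc ∑' a, p.law a * (f a.1).prob s
      ≤ ∑' a, ({z | z.1 ∈ A}.indicator (⇑p.law) a * c + p.law a * c') := by
        refine ENNReal.tsum_le_tsum fun a => ?_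
        by_cases ha : a.1 ∈ A
        · rw [Set.indicator_of_mem (show a ∈ {z : α × ℕ | z.1 ∈ A} from ha)]
          exact (mul_le_mul_right (h _ ha) _).trans le_self_add
        · rw [Set.indicator_of_notMem (show a ∉ {z : α × ℕ | z.1 ∈ A} from ha), zero_mul, zero_add]
          exact mul_le_mul_right (h' _ ha) _
    _ = _ := by
        rw [ENNReal.tsum_add, ENNReal.tsum_mul_right, ENNReal.tsum_mul_right,
          p.law.tsum_coe, one_mul]

/-- The union bound for sequential composition: a failure of the first step is charged in full, and
later steps are only analysed after a success. -/
lemma prob_bind_le_add {α β : Type} (p : Proc α) (f : α → Proc β) (s : Set β) (A : Set α)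
    {c : ENNReal} (h : ∀ a ∉ A, (f a).prob s ≤ c) : (p >>= f).prob s ≤ p.prob A + c := by
  simpa using prob_bind_le p f s A (fun a _ => prob_le_one (f a) s) h

lemma prob_map_le {α β : Type} (p : Proc α) (f : α → β) (s : Set β) (A : Set α)
    (h : ∀ a ∉ A, f a ∉ s) : (p >>= fun a => pure (f a)).prob s ≤ p.prob A := by
  simpa using prob_bind_le_add p (fun a => pure (f a)) s A (c := 0)
    fun a ha => (prob_pure (h a ha)).le

/-- Every run of the procedure uses `U` at least `n` times. -/
def UsesAtLeast {α : Type} (p : Proc α) (n : ℕ) : Prop := ∀ z ∈ p.law.support, n ≤ z.2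

lemma mem_support_bind {α β : Type} {p : Proc α} {f : α → Proc β} {z : β × ℕ}
    (hz : z ∈ (p >>= f).law.support) :
    ∃ a ∈ p.law.support, ∃ b ∈ (f a.1).law.support, z = (b.1, a.2 + b.2) := by
  change z ∈ (p.law.bind fun a => (f a.1).law.map fun b => (b.1, a.2 + b.2)).support at hz
  rw [PMF.mem_support_bind_iff] at hz
  obtain ⟨a, ha, hz⟩ := hz
  rw [PMF.mem_support_map_iff] at hz
  obtain ⟨b, hb, rfl⟩ := hz
  exact ⟨a, ha, b, hb, rfl⟩

lemma UsesAtLeast.bind_left {α β : Type} {p : Proc α} {n : ℕ} (h : p.UsesAtLeast n)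
    (f : α → Proc β) : (p >>= f).UsesAtLeast n := by
  intro z hz
  obtain ⟨a, ha, b, -, rfl⟩ := mem_support_bind hz
  exact (h a ha).trans (Nat.le_add_right _ _)

lemma UsesAtLeast.bind_right {α β : Type} (p : Proc α) {n : ℕ} {f : α → Proc β}
    (h : ∀ a, (f a).UsesAtLeast n) : (p >>= f).UsesAtLeast n := by
  intro z hz
  obtain ⟨a, -, b, hb, rfl⟩ := mem_support_bind hz
  exact (h a.1 b hb).trans (Nat.le_add_left _ _)

lemma UsesAtLeast.power {p : Proc ℝ} {n : ℕ} (h : p.UsesAtLeast n) (K δ : ℝ) :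
    (p.power K δ).UsesAtLeast n := by
  refine UsesAtLeast.bind_left ?_ _
  -- The number of repetitions is odd, hence a successor, so at least one run of `p` takes place.
  rw [reps, runs]
  exact h.bind_left _

lemma UsesAtLeast.le_of_usesAtMost {α : Type} {p : Proc α} {n T : ℕ} (h : p.UsesAtLeast n)
    (h' : p.UsesAtMost T) : n ≤ T := by
  obtain ⟨z, hz⟩ := p.law.support_nonempty
  exact (h z hz).trans (h' z hz)

/-! ### Medians of independent runs -/

lemma length_of_mem_support_runs (p : Proc ℝ) (n : ℕ) :
    ∀ z ∈ (p.runs n).law.support, z.1.length = n := by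
  induction n with
  | zero =>
    intro z hz
    change z ∈ (PMF.pure (([] : List ℝ), 0)).support at hz
    rw [PMF.mem_support_pure_iff] at hz
    simp [hz]
  | succ n ih =>
    intro z hz
    rw [runs] at hz
    obtain ⟨a, -, b, hb, rfl⟩ := mem_support_bind hz
    obtain ⟨c, hc, d, hd, rfl⟩ := mem_support_bind hb
    change d ∈ (PMF.pure (a.1 :: c.1, 0)).support at hd
    rw [PMF.mem_support_pure_iff] at hd
    simp [hd, ih c hc]

open Classical in
/-- The probability that at least `c` of `n` independent runs return a value in `s`. -/
lemma prob_runs_countP_le (p : Proc ℝ) (s : Set ℝ) (n c : ℕ) :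
    (p.runs n).prob {l | c ≤ l.countP (· ∈ s)} ≤ 2 ^ n * p.prob s ^ c := by
  induction n generalizing c with
  | zero =>
    cases c with
    | zero => simpa using prob_le_one _ _
    | succ c =>
      have : (p.runs 0).prob {l | c + 1 ≤ l.countP (· ∈ s)} = 0 := prob_pure (by simp)
      rw [this]
      exact zero_le
  | succ n ih =>
    cases c with
    | zero =>
      refine (prob_le_one _ _).trans ?_
      simpa using one_le_pow₀ (one_le_two (α := ENNReal))
    | succ c =>
      rw [runs]
      -- Condition on the first run: if it lands in `s`, only `c` further hits are needed. Both
      -- terms equal `2 ^ n * p.prob s ^ (c + 1)`, and the doubling produces the factor `2 ^ (n +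
      -- 1)`.
      calc _ ≤ p.prob s * (2 ^ n * p.prob s ^ c) + 2 ^ n * p.prob s ^ (c + 1) := by
            refine prob_bind_le _ _ _ s (fun a ha => ?_) (fun a ha => ?_)
            · refine (prob_map_le _ _ _ {l | c ≤ l.countP (· ∈ s)} fun l hl => ?_).trans (ih c)
              simpa [List.countP_cons, ha] using hl
            · refine (prob_map_le _ _ _ {l | c + 1 ≤ l.countP (· ∈ s)}
                fun l hl => ?_).trans (ih (c + 1))
              simpa [List.countP_cons, ha] using hl
        _ = _ := by ring

end Proc

open Classical in
/-- If the median lies outside an interval, then so do more than half of the entries. -/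
lemma length_lt_countP_of_median_notMem {l : List ℝ} (hl : Odd l.length) {a b : ℝ}
    (h : median l ∉ Set.Icc a b) :
    l.length / 2 + 1 ≤ l.countP (· ∈ {v | v ∉ Set.Icc a b}) := by
  set m := l.mergeSort (fun a b => decide (a ≤ b)) with hm
  have hperm : m.Perm l := List.mergeSort_perm _ _
  have hlen : m.length = l.length := hperm.length_eq
  have hlt : l.length / 2 < m.length := by
    have := hl.pos
    omega
  have hsort : m.Pairwise (· ≤ ·) := by
    have := List.pairwise_mergeSort (le := fun a b : ℝ => decide (a ≤ b))
      (by simp only [decide_eq_true_eq]; exact fun a b c => le_trans)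
      (by simp only [Bool.or_eq_true, decide_eq_true_eq]; exact le_total) l
    simpa using this
  have hmed : median l = m[l.length / 2] := by
    rw [median, ← hm, List.getD_eq_getElem _ _ hlt]
  rw [hmed] at h
  rw [← hperm.countP_eq]
  have hmono : ∀ i j (hi : i < m.length) (hj : j < m.length), i ≤ j → m[i] ≤ m[j] := by
    intro i j hi hj hij
    rcases hij.eq_or_lt with rfl | hij
    · exact le_rfl
    · exact List.pairwise_iff_getElem.1 hsort i j hi hj hij
  -- A median below `a` forces the sorted entries up to and including the middle one below `a`; a
  -- median above `b` forces those from the middle one on above `b`.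
  rcases lt_or_ge m[l.length / 2] a with h1 | h1
  · have hall : ∀ v ∈ m.take (l.length / 2 + 1), decide (v ∈ {v | v ∉ Set.Icc a b}) = true := by
      intro v hv
      obtain ⟨i, hi, rfl⟩ := List.mem_iff_getElem.1 hv
      rw [List.length_take] at hi
      rw [List.getElem_take]
      have := hmono i (l.length / 2) (by omega) hlt (by omega)
      exact decide_eq_true fun hv' => absurd hv'.1 (not_le.2 (this.trans_lt h1))
    have h2 := List.countP_eq_length.2 hall
    rw [List.length_take, min_eq_left (by omega)] at h2
    rw [← h2]
    exact (List.take_sublist _ _).countP_le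
  · have h1 : b < m[l.length / 2] := not_le.1 fun h2 => h ⟨h1, h2⟩
    have hall : ∀ v ∈ m.drop (l.length / 2), decide (v ∈ {v | v ∉ Set.Icc a b}) = true := by
      intro v hv
      obtain ⟨i, hi, rfl⟩ := List.mem_iff_getElem.1 hv
      rw [List.length_drop] at hi
      rw [List.getElem_drop]
      have := hmono (l.length / 2) (l.length / 2 + i) hlt (by omega) (by omega)
      exact decide_eq_true fun hv' => absurd hv'.2 (not_le.2 (h1.trans_le this))
    have h2 := List.countP_eq_length.2 hall
    rw [List.length_drop] at h2
    have h3 : m.length - l.length / 2 ≤ m.countP (fun v => decide (v ∈ {v | v ∉ Set.Icc a b})) := by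
      rw [← h2]
      exact (List.drop_sublist _ _).countP_le
    obtain ⟨r, hr⟩ := hl
    omega

/-- With `2r + 1` runs of failure probability `1/5`, counting subsets leaves `2/5 * (4/5)^r`, and
`log (4/5) ≤ -1/5` with `r ≥ 10 log (1/δ)` gives the exponent `2`. The square matters at the end:
three failure probabilities of `1/9` would add up to more than `3/10`. -/
lemma power_reps_bound {K δ : ℝ} (hK : 10 ≤ K) (hδ : 0 < δ) (hδ1 : δ ≤ 1) :
    2 ^ reps K δ * (1 / 5 : ℝ) ^ (reps K δ / 2 + 1) ≤ δ ^ 2 := by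
  have hlog : 0 ≤ Real.log (1 / δ) := Real.log_nonneg ((one_le_div hδ).2 hδ1)
  set r := ⌈K * Real.log (1 / δ)⌉₊ with hr
  have h1 : reps K δ = 2 * r + 1 := rfl
  have h2 : reps K δ / 2 = r := by omega
  have h3 : 10 * Real.log (1 / δ) ≤ r :=
    (mul_le_mul_of_nonneg_right hK hlog).trans (Nat.le_ceil _)
  have h4 : Real.log (4 / 5) ≤ -(1 / 5) := by
    have := Real.log_le_sub_one_of_pos (show (0 : ℝ) < 4 / 5 by norm_num)
    linarith
  have h5 : ((4 : ℝ) / 5) ^ r ≤ δ ^ 2 := by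
    rw [← Real.log_le_log_iff (by positivity) (by positivity), Real.log_pow, Real.log_pow]
    rw [one_div, Real.log_inv] at h3
    have : (r : ℝ) * Real.log (4 / 5) ≤ r * (-(1 / 5)) :=
      mul_le_mul_of_nonneg_left h4 (Nat.cast_nonneg _)
    push_cast
    linarith
  calc 2 ^ reps K δ * (1 / 5 : ℝ) ^ (reps K δ / 2 + 1) = 2 / 5 * ((4 : ℝ) / 5) ^ r := by
        have : ((4 : ℝ) / 5) ^ r = 2 ^ (2 * r) * (1 / 5) ^ r := by
          rw [pow_mul, ← mul_pow]
          norm_num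
        rw [h2, h1, this]
        ring
    _ ≤ 1 * ((4 : ℝ) / 5) ^ r := by gcongr; norm_num
    _ ≤ δ ^ 2 := by rwa [one_mul]

/-- The probability that the median of `n` independent runs lies outside an interval. -/
lemma Proc.prob_runs_median_le {p : Proc ℝ} {n : ℕ} (hn : Odd n) (a b : ℝ) :
    (p.runs n).prob {l | median l ∉ Set.Icc a b} ≤
      2 ^ n * p.prob {v | v ∉ Set.Icc a b} ^ (n / 2 + 1) := by
  classical
  refine le_trans ?_ (prob_runs_countP_le p _ _ _)
  -- Only lists in the support count, and these have length exactly `n`, which is odd.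
  refine PMF.toOuterMeasure_mono _ ?_
  rintro z ⟨hz, hz'⟩
  have hlen := length_of_mem_support_runs p _ z hz'
  have := length_lt_countP_of_median_notMem (l := z.1) (hlen ▸ hn) hz
  rw [hlen] at this
  simp only [Set.mem_ofPred_eq]
  convert this

/-- Taking the median of independent runs amplifies the success probability. -/
lemma Proc.prob_power_le {p : Proc ℝ} {a e K δ : ℝ} (hK : 10 ≤ K) (hδ : 0 < δ) (hδ1 : δ ≤ 1)
    (hp : p.prob {v | ¬ |v - a| ≤ e} ≤ ENNReal.ofReal (1 / 5)) :
    (p.power K δ).prob {v | ¬ |v - a| ≤ e} ≤ ENNReal.ofReal (δ ^ 2) := by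
  have hs : {v : ℝ | ¬ |v - a| ≤ e} = {v | v ∉ Set.Icc (a - e) (a + e)} := by
    ext v
    simp only [Set.mem_ofPred_eq, Set.mem_Icc, abs_le, not_iff_not]
    constructor <;> rintro ⟨h1, h2⟩ <;> constructor <;> linarith
  rw [hs] at hp ⊢
  have hr : Odd (reps K δ) := ⟨_, rfl⟩
  have hb := power_reps_bound hK hδ hδ1
  rw [power]
  generalize reps K δ = n at hr hb
  refine (prob_map_le _ median _ {l | median l ∉ Set.Icc (a - e) (a + e)} fun l hl => hl).trans ?_
  refine (prob_runs_median_le hr _ _).trans ?_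
  refine le_trans ?_ (ENNReal.ofReal_le_ofReal hb)
  rw [ENNReal.ofReal_mul (by positivity), ENNReal.ofReal_pow (by norm_num),
    ENNReal.ofReal_pow (by norm_num), ENNReal.ofReal_ofNat]
  gcongr

/-! ### Tails of the Fejér kernel -/

lemma sum_inv_sq_le_third {ι : Type} (S : Finset ι) (f : ι → ℕ) (hf : Set.InjOn f S)
    (h6 : ∀ j ∈ S, 6 ≤ f j) : ∑ j ∈ S, (((f j : ℕ) : ℝ) ^ 2)⁻¹ ≤ 1 / 3 := by
  classical
  calc ∑ j ∈ S, (((f j : ℕ) : ℝ) ^ 2)⁻¹ = ∑ n ∈ S.image f, ((n : ℝ) ^ 2)⁻¹ :=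
        (Finset.sum_image (f := fun n : ℕ => ((n : ℝ) ^ 2)⁻¹) hf).symm
    _ ≤ ∑ n ∈ Finset.Ioo 5 (∑ j ∈ S, f j + 1), ((n : ℝ) ^ 2)⁻¹ := by
        refine Finset.sum_le_sum_of_subset_of_nonneg ?_ fun _ _ _ => by positivity
        intro n hn
        obtain ⟨j, hj, rfl⟩ := Finset.mem_image.1 hn
        have := Finset.single_le_sum (f := f) (fun _ _ => Nat.zero_le _) hj
        have := h6 j hj
        rw [Finset.mem_Ioo]
        omega
    _ ≤ 2 / ((5 : ℕ) + 1) := sum_Ioo_inv_sq_le _ _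
    _ = 1 / 3 := by norm_num

/-- The representative of `x` modulo `t` closest to `0`. -/
noncomputable def centred (t x : ℝ) : ℝ := x - t * round (x / t)

lemma abs_centred_le {t : ℝ} (ht : 0 < t) (x : ℝ) : |centred t x| ≤ t / 2 := by
  have h : centred t x = t * (x / t - round (x / t)) := by
    rw [centred]
    field_simp
  rw [h, abs_mul, abs_of_pos ht]
  have := abs_sub_round (x / t)
  nlinarith

/-- Up to the common shift `Int.fract s`, the centred distances are distinct integers `h j`, because
`h j` determines `j` modulo `t`. On either side of `0` the squares are therefore bounded below by
squares of distinct integers that are at least `6`, and each side contributes at most `1/3`. -/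
lemma sum_inv_centred_sq_le (t : ℕ+) (s : ℝ) (S : Finset (Fin t))
    (hS : ∀ j ∈ S, 6 < |centred t ((j : ℕ) - s)|) :
    ∑ j ∈ S, (centred t ((j : ℕ) - s) ^ 2)⁻¹ ≤ 2 / 3 := by
  classical
  set d : Fin t → ℝ := fun j => centred t ((j : ℕ) - s) with hd
  set h : Fin t → ℤ := fun j => (j : ℕ) - (t : ℕ) * round ((((j : ℕ) : ℝ) - s) / (t : ℕ)) - ⌊s⌋
    with hh
  have hdh : ∀ j, d j = h j - Int.fract s := by
    intro j
    have := Int.floor_add_fract s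
    simp only [hd, hh, centred]
    push_cast
    linarith
  have hinj : ∀ i j, h i = h j → i = j := by
    intro i j hij
    have h1 : ((i : ℕ) : ℤ) ≡ ((j : ℕ) : ℤ) [ZMOD (t : ℕ)] := by
      rw [Int.modEq_iff_dvd]
      refine ⟨round ((((j : ℕ) : ℝ) - s) / (t : ℕ)) - round ((((i : ℕ) : ℝ) - s) / (t : ℕ)), ?_⟩
      simp only [hh] at hij
      linear_combination -hij
    have h2 := Nat.ModEq.eq_of_lt_of_lt (Int.natCast_modEq_iff.1 h1) i.2 j.2
    exact Fin.ext h2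
  have hf0 := Int.fract_nonneg s
  have hf1 := Int.fract_lt_one s
  have hpos : ∑ j ∈ S with 0 < d j, (d j ^ 2)⁻¹ ≤ 1 / 3 := by
    -- On this side `d j` is smaller than `h j`, so the comparison is with `h j - 1 ≥ 6`; on the
    -- negative side the fractional part helps and `-h j` itself serves.
    have key : ∀ j ∈ S.filter (fun j => 0 < d j), 7 ≤ h j := by
      intro j hj
      rw [Finset.mem_filter] at hj
      have h1 := hS j hj.1
      change 6 < |d j| at h1
      rw [abs_of_pos hj.2, hdh] at h1
      have : (6 : ℝ) < h j := by linarith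
      have : (6 : ℤ) < h j := by exact_mod_cast this
      omega
    refine le_trans (Finset.sum_le_sum fun j hj => ?_)
      (sum_inv_sq_le_third (S.filter (fun j => 0 < d j)) (fun j => (h j - 1).toNat) ?_ ?_)
    · have h7 := key j hj
      have hc : (((h j - 1).toNat : ℕ) : ℝ) = h j - 1 := by
        have : (((h j - 1).toNat : ℕ) : ℤ) = h j - 1 := Int.toNat_of_nonneg (by omega)
        exact_mod_cast this
      have h7' : (7 : ℝ) ≤ h j := by exact_mod_cast h7
      rw [hc]
      refine inv_anti₀ (by nlinarith) ?_
      rw [hdh]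
      exact pow_le_pow_left₀ (by linarith) (by linarith) 2
    · intro i hi j hj hij
      have h1 := key i hi
      have h2 := key j hj
      refine hinj i j ?_
      simp only at hij
      omega
    · intro j hj
      have := key j hj
      omega
  have hneg : ∑ j ∈ S with ¬ 0 < d j, (d j ^ 2)⁻¹ ≤ 1 / 3 := by
    have key : ∀ j ∈ S.filter (fun j => ¬ 0 < d j), h j ≤ -6 := by
      intro j hj
      rw [Finset.mem_filter] at hj
      have h1 := hS j hj.1
      change 6 < |d j| at h1
      rw [abs_of_nonpos (not_lt.1 hj.2), hdh] at h1
      have : (h j : ℝ) < (-5 : ℤ) := by push_cast; linarith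
      have : h j < (-5 : ℤ) := by exact_mod_cast this
      omega
    refine le_trans (Finset.sum_le_sum fun j hj => ?_)
      (sum_inv_sq_le_third (S.filter (fun j => ¬ 0 < d j)) (fun j => (- h j).toNat) ?_ ?_)
    · have h7 := key j hj
      have hc : (((- h j).toNat : ℕ) : ℝ) = - h j := by
        have : (((- h j).toNat : ℕ) : ℤ) = - h j := Int.toNat_of_nonneg (by omega)
        exact_mod_cast this
      have h7' : (h j : ℝ) ≤ -6 := by exact_mod_cast h7
      rw [hc]
      refine inv_anti₀ (by nlinarith) ?_
      rw [hdh]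
      nlinarith
    · intro i hi j hj hij
      have h1 := key i hi
      have h2 := key j hj
      refine hinj i j ?_
      simp only at hij
      omega
    · intro j hj
      have := key j hj
      omega
  rw [← Finset.sum_filter_add_sum_filter_not S (fun j => 0 < d j)]
  linarith

/-- The probability of the outcome `j` of phase estimation with the eigenvalue `exp (2 i θ)`. -/
noncomputable def phaseWeight (t : ℕ) (θ : ℝ) (j : ℕ) : ℝ :=
  ‖∑ y ∈ Finset.range t,
    Complex.exp (Complex.I * ((2 * (θ - Real.pi * j / t) : ℝ) : ℂ)) ^ y‖ ^ 2 / t ^ 2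

/-- For `z = exp (2ix)`, the product of the geometric sum and `z - 1` is `z^t - 1`, of norm at most
`2`, while `‖z - 1‖ = 2 |sin x|`. -/
lemma norm_geom_sum_exp_mul_le (x : ℝ) (t : ℕ) :
    ‖∑ y ∈ Finset.range t, Complex.exp (Complex.I * ((2 * x : ℝ) : ℂ)) ^ y‖ * |Real.sin x| ≤ 1 := by
  have h1 := geom_sum_mul (Complex.exp (Complex.I * ((2 * x : ℝ) : ℂ))) t
  have h2 := congrArg (fun z => ‖z‖) h1
  simp only [norm_mul] at h2
  rw [Complex.norm_exp_I_mul_ofReal_sub_one, Real.norm_eq_abs, abs_mul, abs_two,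
    mul_div_cancel_left₀ x two_ne_zero] at h2
  have h3 : ‖Complex.exp (Complex.I * ((2 * x : ℝ) : ℂ)) ^ t - 1‖ ≤ 2 := by
    refine (norm_sub_le _ _).trans ?_
    rw [norm_pow, mul_comm, Complex.norm_exp_ofReal_mul_I]
    norm_num
  linarith

lemma sin_sq_centred {t : ℝ} (ht : t ≠ 0) (θ j : ℝ) :
    ∃ n : ℤ, Real.pi * j / t = θ + Real.pi / t * centred t (j - t * θ / Real.pi) +
      n * Real.pi := by
  refine ⟨round ((j - t * θ / Real.pi) / t), ?_⟩
  have := Real.pi_ne_zero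
  rw [centred]
  field_simp
  ring

lemma sin_add_int_mul_pi_sq (x : ℝ) (n : ℤ) : Real.sin (x + n * Real.pi) ^ 2 = Real.sin x ^ 2 := by
  rw [Real.sin_add_int_mul_pi, mul_pow, ← zpow_natCast, ← zpow_mul, mul_comm n, zpow_mul]
  simp

/-- Modulo `π`, the phase error is `π d / t` up to sign, with `|d| ≤ t/2`. Jordan's inequality
bounds its sine below by `2|d|/t`, and the geometric sum is at most the inverse of that. -/
lemma phaseWeight_le (t : ℕ+) (θ : ℝ) (j : ℕ) (hd : centred t (j - t * θ / Real.pi) ≠ 0) :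
    phaseWeight t θ j ≤ 1 / 4 * (centred t (j - t * θ / Real.pi) ^ 2)⁻¹ := by
  have ht : (0 : ℝ) < (t : ℕ) := by exact_mod_cast t.pos
  set d := centred t (j - t * θ / Real.pi) with hd'
  have hdpos : 0 < |d| := abs_pos.2 hd
  have hpi := Real.pi_pos
  have hle : |d| ≤ (t : ℕ) / 2 := abs_centred_le ht _
  set x := θ - Real.pi * j / t with hx
  have hsin : 2 * |d| / (t : ℕ) ≤ |Real.sin x| := by
    obtain ⟨n, hn⟩ := sin_sq_centred ht.ne' θ j
    have h1 : |Real.sin x| = |Real.sin (Real.pi / (t : ℕ) * d)| := by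
      rw [← sq_eq_sq_iff_abs_eq_abs, ← sin_add_int_mul_pi_sq (Real.pi / (t : ℕ) * d) n,
        ← neg_sq, ← Real.sin_neg]
      congr 2
      rw [hx]
      linarith
    have h2 : |Real.sin (Real.pi / (t : ℕ) * d)| = |Real.sin (Real.pi / (t : ℕ) * |d|)| := by
      rcases abs_choice d with h | h <;> rw [h]
      rw [mul_neg, Real.sin_neg, abs_neg]
    have h3 : Real.pi / (t : ℕ) * |d| ≤ Real.pi / 2 := by
      rw [div_mul_eq_mul_div, div_le_iff₀ ht]
      nlinarith
    have h4 := Real.mul_le_sin (x := Real.pi / (t : ℕ) * |d|) (by positivity) h3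
    rw [h1, h2]
    refine le_trans (le_trans (le_of_eq ?_) h4) (le_abs_self _)
    field_simp
  have hw := norm_geom_sum_exp_mul_le x t
  rw [phaseWeight, ← hx]
  set g := ‖∑ y ∈ Finset.range t, Complex.exp (Complex.I * ((2 * x : ℝ) : ℂ)) ^ y‖
  have hg : 0 ≤ g := norm_nonneg _
  have h5 : g * (2 * |d| / (t : ℕ)) ≤ 1 := (mul_le_mul_of_nonneg_left hsin hg).trans hw
  have h6 : (g * (2 * |d| / (t : ℕ))) ^ 2 ≤ 1 := pow_le_one₀ (by positivity) h5
  have h7 : g ^ 2 / (t : ℕ) ^ 2 * (4 * d ^ 2) ≤ 1 := by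
    rw [← sq_abs d]
    calc _ = (g * (2 * |d| / (t : ℕ))) ^ 2 := by ring
      _ ≤ 1 := h6
  have hd2 : 0 < d ^ 2 := by positivity
  rw [← one_div, div_mul_div_comm, one_mul, le_div_iff₀ (by positivity)]
  exact h7

lemma abs_sin_sq_sub_sin_sq_le (t : ℕ+) (θ : ℝ) (j : ℕ)
    (hd : |centred t (j - t * θ / Real.pi)| ≤ 6) :
    |Real.sin (Real.pi * j / t) ^ 2 - Real.sin θ ^ 2| ≤
      400 * (|Real.sin θ| / t + 1 / t ^ 2) := by
  have ht : (0 : ℝ) < (t : ℕ) := by exact_mod_cast t.pos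
  obtain ⟨n, hn⟩ := sin_sq_centred ht.ne' θ j
  set d := centred t (j - t * θ / Real.pi)
  set x := Real.pi / (t : ℕ) * d with hx
  rw [hn, sin_add_int_mul_pi_sq]
  -- `6π < 20`; the square of this `20` is the constant `400`.
  have hxle : |x| ≤ 20 / (t : ℕ) := by
    rw [hx, abs_mul, abs_of_pos (div_pos Real.pi_pos ht), div_mul_eq_mul_div]
    have := Real.pi_lt_d2
    have := Real.pi_pos
    gcongr
    nlinarith [abs_nonneg d]
  have h1 : Real.sin (θ + x) ^ 2 - Real.sin θ ^ 2 = Real.sin (2 * θ + x) * Real.sin x := by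
    rw [two_mul, add_assoc, Real.sin_add θ (θ + x), Real.sin_add, Real.cos_add]
    have := Real.sin_sq_add_cos_sq θ
    have := Real.sin_sq_add_cos_sq x
    grind
  have h2 : |Real.sin (2 * θ + x)| ≤ 2 * |Real.sin θ| + |x| := by
    rw [Real.sin_add, Real.sin_two_mul]
    refine (abs_add_le _ _).trans ?_
    have c1 := Real.abs_cos_le_one θ
    have c2 := Real.abs_cos_le_one x
    have c3 := Real.abs_cos_le_one (2 * θ)
    have c4 := Real.abs_sin_le_abs (x := x)
    rw [abs_mul, abs_mul, abs_mul, abs_mul, abs_two]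
    refine add_le_add ?_ ?_
    · refine mul_le_of_le_one_right (by positivity) c2 |>.trans ?_
      exact mul_le_of_le_one_right (by positivity) c1
    · exact (mul_le_of_le_one_left (abs_nonneg _) c3).trans c4
  rw [h1, abs_mul]
  calc |Real.sin (2 * θ + x)| * |Real.sin x| ≤ (2 * |Real.sin θ| + 20 / (t : ℕ)) * (20 / (t : ℕ)) :=
        mul_le_mul (h2.trans (by linarith)) (Real.abs_sin_le_abs.trans hxle) (abs_nonneg _)
          (by positivity)
    _ = 40 * (|Real.sin θ| / (t : ℕ)) + 400 * (1 / (t : ℕ) ^ 2) := by ring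
    _ ≤ 400 * (|Real.sin θ| / (t : ℕ) + 1 / (t : ℕ) ^ 2) := by
        have : 0 ≤ |Real.sin θ| / (t : ℕ) := by positivity
        linarith

/-- Phase estimation with parameter `t` fails to estimate `sin² θ` with small probability. -/
lemma sum_phaseWeight_le (t : ℕ+) (θ : ℝ) (S : Finset (Fin t))
    (hS : ∀ j ∈ S, ¬ |Real.sin (Real.pi * (j : ℕ) / t) ^ 2 - Real.sin θ ^ 2| ≤
      400 * (|Real.sin θ| / t + 1 / t ^ 2)) : ∑ j ∈ S, phaseWeight t θ j ≤ 1 / 5 := by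
  have h6 : ∀ j ∈ S, 6 < |centred t ((j : ℕ) - t * θ / Real.pi)| := fun j hj =>
    not_le.1 fun h => hS j hj (abs_sin_sq_sub_sin_sq_le t θ j h)
  calc ∑ j ∈ S, phaseWeight t θ j
      ≤ ∑ j ∈ S, 1 / 4 * (centred t ((j : ℕ) - t * θ / Real.pi) ^ 2)⁻¹ := by
        refine Finset.sum_le_sum fun j hj => phaseWeight_le t θ j ?_
        have := h6 j hj
        exact abs_pos.1 (by linarith)
    _ ≤ 1 / 5 := by
        rw [← Finset.mul_sum]
        have := sum_inv_centred_sq_le t _ S h6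
        linarith

/-! ### The outcome distribution of amplitude estimation -/

section
variable {ι : Type} [Fintype ι] [DecidableEq ι]

lemma reflU_mulVec (ψ x : ι → ℂ) : reflU ψ *ᵥ x = (2 * (star ψ ⬝ᵥ x)) • ψ - x := by
  rw [reflU, Matrix.sub_mulVec, Matrix.one_mulVec, Matrix.smul_mulVec, Matrix.vecMulVec_mulVec]
  ext i
  simp [mul_assoc, mul_comm]

lemma reflV_mulVec (P : Matrix ι ι ℂ) (x : ι → ℂ) : reflV P *ᵥ x = x - (2 : ℂ) • (P *ᵥ x) := by
  rw [reflV, Matrix.sub_mulVec, Matrix.one_mulVec, Matrix.smul_mulVec]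
  ext i
  simp

/-- The correlations of the iterates of `UV` on `ψ`. -/
lemma dotProduct_iterate {ψ : ι → ℂ} (hψ : IsState ψ) {P : Matrix ι ι ℂ}
    (hP : IsStarProjection P) {θ : ℝ}
    (hθ : star ψ ⬝ᵥ (P *ᵥ ψ) = ((Real.sin θ ^ 2 : ℝ) : ℂ)) (n : ℕ) :
    star ψ ⬝ᵥ ((reflU ψ * reflV P) ^ n *ᵥ ψ) = ((Real.cos (2 * n * θ) : ℝ) : ℂ) := by
  have h1 := (isState_iff ψ).1 hψ
  have hUψ : reflU ψ *ᵥ ψ = ψ := by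
    rw [reflU_mulVec, h1, mul_one, two_smul, add_sub_cancel_right]
  have hcos : ((Real.cos (2 * θ) : ℝ) : ℂ) = 1 - 2 * ((Real.sin θ ^ 2 : ℝ) : ℂ) := by
    rw [Real.cos_two_mul, Real.cos_sq']
    push_cast
    ring
  have hVψ : star ψ ⬝ᵥ (reflV P *ᵥ ψ) = ((Real.cos (2 * θ) : ℝ) : ℂ) := by
    rw [reflV_mulVec, dotProduct_sub, dotProduct_smul, h1, hθ, hcos, smul_eq_mul]
  have hVV : reflV P * reflV P = 1 := by
    have h := Matrix.mem_unitaryGroup_iff.1 (reflV_mem hP)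
    have h2 : star (reflV P) = reflV P := by
      simp only [reflV, star_sub, star_one, star_nsmul]
      rw [hP.isSelfAdjoint.star_eq]
    rwa [h2] at h
  set Q := reflU ψ * reflV P with hQ
  have hQψ : Q *ᵥ ψ = (2 * ((Real.cos (2 * θ) : ℝ) : ℂ)) • ψ - reflV P *ᵥ ψ := by
    rw [hQ, ← Matrix.mulVec_mulVec, reflU_mulVec, hVψ]
  have hQV : Q *ᵥ (reflV P *ᵥ ψ) = ψ := by
    rw [Matrix.mulVec_mulVec, hQ, mul_assoc, hVV, mul_one, hUψ]
  -- The iterates satisfy the Chebyshev recurrence of `cos (2nθ)`, since `Qψ + Vψ = 2 cos (2θ) ψ`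
  -- and `QVψ = ψ`. This covers the degenerate angles, where `Pψ` or `ψ - Pψ` vanishes, without a
  -- separate case.
  have hrec : ∀ n : ℕ, Q ^ (n + 2) *ᵥ ψ =
      (2 * ((Real.cos (2 * θ) : ℝ) : ℂ)) • (Q ^ (n + 1) *ᵥ ψ) - Q ^ n *ᵥ ψ := by
    intro n
    have h2 : Q *ᵥ (Q *ᵥ ψ) = (2 * ((Real.cos (2 * θ) : ℝ) : ℂ)) • (Q *ᵥ ψ) - ψ := by
      conv_lhs => rw [hQψ]
      rw [Matrix.mulVec_sub, Matrix.mulVec_smul, hQV]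
    rw [pow_add, pow_two, ← Matrix.mulVec_mulVec, ← Matrix.mulVec_mulVec, h2, Matrix.mulVec_sub,
      Matrix.mulVec_smul, Matrix.mulVec_mulVec, ← pow_succ]
  induction n using Nat.twoStepInduction with
  | zero => simp [h1]
  | one =>
    rw [pow_one, hQψ, dotProduct_sub, dotProduct_smul, h1, hVψ, smul_eq_mul, Nat.cast_one, mul_one, mul_one]
    ring
  | more n ih1 ih2 =>
    have h : Real.cos (2 * ((n + 2 : ℕ) : ℝ) * θ) =
        2 * Real.cos (2 * θ) * Real.cos (2 * ((n + 1 : ℕ) : ℝ) * θ) - Real.cos (2 * n * θ) := by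
      rw [show 2 * ((n + 2 : ℕ) : ℝ) * θ = 2 * ((n + 1 : ℕ) : ℝ) * θ + 2 * θ by push_cast; ring,
        show 2 * (n : ℝ) * θ = 2 * ((n + 1 : ℕ) : ℝ) * θ - 2 * θ by push_cast; ring,
        Real.cos_add, Real.cos_sub]
      ring
    rw [hrec, dotProduct_sub, dotProduct_smul, ih1, ih2, smul_eq_mul, h, Complex.ofReal_sub,
      Complex.ofReal_mul, Complex.ofReal_mul, Complex.ofReal_ofNat]

lemma star_mulVec_dotProduct_mulVec {M : Matrix ι ι ℂ} (hM : M ∈ Matrix.unitaryGroup ι ℂ)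
    (x y : ι → ℂ) : star (M *ᵥ x) ⬝ᵥ (M *ᵥ y) = star x ⬝ᵥ y := by
  rw [Matrix.star_mulVec, Matrix.dotProduct_mulVec, Matrix.vecMul_vecMul,
    ← Matrix.star_eq_conjTranspose, Matrix.mem_unitaryGroup_iff'.1 hM, Matrix.vecMul_one]

/-- By unitarity the inner product depends only on `n - m`; conjugate symmetry handles `n < m`. -/
lemma dotProduct_iterate_iterate {ψ : ι → ℂ} (hψ : IsState ψ) {P : Matrix ι ι ℂ}
    (hP : IsStarProjection P) {θ : ℝ}
    (hθ : star ψ ⬝ᵥ (P *ᵥ ψ) = ((Real.sin θ ^ 2 : ℝ) : ℂ)) (m n : ℕ) :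
    star ((reflU ψ * reflV P) ^ m *ᵥ ψ) ⬝ᵥ ((reflU ψ * reflV P) ^ n *ᵥ ψ) =
      ((Real.cos (2 * ((n : ℝ) - m) * θ) : ℝ) : ℂ) := by
  have hQ : reflU ψ * reflV P ∈ Matrix.unitaryGroup ι ℂ := mul_mem (reflU_mem hψ) (reflV_mem hP)
  have key : ∀ m k : ℕ, star ((reflU ψ * reflV P) ^ m *ᵥ ψ) ⬝ᵥ
      ((reflU ψ * reflV P) ^ (m + k) *ᵥ ψ) = ((Real.cos (2 * k * θ) : ℝ) : ℂ) := by
    intro m k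
    rw [pow_add, ← Matrix.mulVec_mulVec, star_mulVec_dotProduct_mulVec (pow_mem hQ m),
      dotProduct_iterate hψ hP hθ]
  rcases le_total m n with h | h
  · obtain ⟨k, rfl⟩ := Nat.exists_eq_add_of_le h
    rw [key]
    push_cast
    ring_nf
  · obtain ⟨k, rfl⟩ := Nat.exists_eq_add_of_le h
    rw [← star_star (star _ ⬝ᵥ _), ← Matrix.star_dotProduct, key, RCLike.star_def,
      Complex.conj_ofReal, ← Real.cos_neg]
    push_cast
    ring_nf

omit [DecidableEq ι] in
-- The norm of a combination depends only on the Gram matrix `c`, so orbits in different spaces can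
-- be compared through their Gram matrices.
lemma sum_norm_sq_sum_smul (s : Finset ℕ) (w : ℕ → ι → ℂ) (x : ℕ → ℂ) (c : ℕ → ℕ → ℂ)
    (hc : ∀ m n, star (w m) ⬝ᵥ w n = c m n) :
    ((∑ i, ‖∑ y ∈ s, x y * w y i‖ ^ 2 : ℝ) : ℂ) =
      ∑ m ∈ s, ∑ n ∈ s, star (x m) * x n * c m n := by
  rw [sum_norm_sq_eq (fun i => ∑ y ∈ s, x y * w y i)]
  have h : (fun i => ∑ y ∈ s, x y * w y i) = ∑ y ∈ s, x y • w y := by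
    ext i
    simp
  rw [h, star_sum, sum_dotProduct]
  refine Finset.sum_congr rfl fun m _ => ?_
  rw [dotProduct_sum]
  refine Finset.sum_congr rfl fun n _ => ?_
  rw [star_smul, smul_dotProduct, dotProduct_smul, hc, smul_eq_mul, smul_eq_mul, mul_assoc]

lemma norm_sq_sum_mul_exp (s : Finset ℕ) (x : ℕ → ℂ) (θ : ℝ) :
    ((‖∑ y ∈ s, x y * Complex.exp (Complex.I * ((2 * y * θ : ℝ) : ℂ))‖ ^ 2 : ℝ) : ℂ) =
      ∑ m ∈ s, ∑ n ∈ s, star (x m) * x n *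
        Complex.exp (Complex.I * ((2 * ((n : ℝ) - m) * θ : ℝ) : ℂ)) := by
  have := sum_norm_sq_sum_smul (ι := Unit) s
    (fun y _ => Complex.exp (Complex.I * ((2 * y * θ : ℝ) : ℂ))) x
    (fun m n => Complex.exp (Complex.I * ((2 * ((n : ℝ) - m) * θ : ℝ) : ℂ))) (by
      intro m n
      simp only [dotProduct, Pi.star_apply, Finset.univ_unique, Finset.sum_const,
        Finset.card_singleton, one_smul, RCLike.star_def]
      rw [← Complex.exp_conj, ← Complex.exp_add]
      congr 1
      rw [map_mul, Complex.conj_I, Complex.conj_ofReal]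
      push_cast
      ring)
  simpa using this

/-- The first Fourier transform acts on `|0⟩` and yields a uniform superposition; its `1/√t` and
that of the inverse transform combine to `1/t`. -/
lemma ampEstState_apply (ψ : ι → ℂ) (P : Matrix ι ι ℂ) (t : ℕ+) (i : ι) (j : Fin t) :
    ampEstState ψ P t (i, j) = (∑ y ∈ Finset.range t,
      Complex.exp (Complex.I * ((-(2 * Real.pi * (j : ℕ) / t) : ℝ) : ℂ)) ^ y *
        ((reflU ψ * reflV P) ^ y *ᵥ ψ) i) / (t : ℕ) := by
  have ht : (0 : ℝ) < (t : ℕ) := by exact_mod_cast t.pos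
  have hsq : ((Real.sqrt ((t : ℕ) : ℝ) : ℂ)) * (Real.sqrt ((t : ℕ) : ℝ) : ℂ) = ((t : ℕ) : ℂ) := by
    rw [← Complex.ofReal_mul, Real.mul_self_sqrt ht.le, Complex.ofReal_natCast]
  have h1 : (((1 : Matrix ι ι ℂ) ⊗ₖ qft t) *ᵥ (fun z => ψ z.1 * ket (0 : Fin t) z.2)) =
      fun z => ψ z.1 / (Real.sqrt ((t : ℕ) : ℝ) : ℂ) := by
    ext ⟨i, j⟩
    simp [Matrix.mulVec, dotProduct, Fintype.sum_prod_type, Matrix.one_apply, ket, qft,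
      Pi.single_apply, div_eq_mul_inv, mul_comm]
  have h2 : Matrix.blockDiagonal (fun y : Fin t => (reflU ψ * reflV P) ^ (y : ℕ)) *ᵥ
      (fun z : ι × Fin t => ψ z.1 / (Real.sqrt ((t : ℕ) : ℝ) : ℂ)) =
      fun z => ((reflU ψ * reflV P) ^ (z.2 : ℕ) *ᵥ ψ) z.1 / (Real.sqrt ((t : ℕ) : ℝ) : ℂ) := by
    ext ⟨i, j⟩
    simp [Matrix.mulVec, dotProduct, Fintype.sum_prod_type, Matrix.blockDiagonal_apply,
      Finset.sum_div, mul_div_assoc]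
  rw [ampEstState, ← Matrix.mulVec_mulVec, h1, ← Matrix.mulVec_mulVec, h2]
  have h3 : ∀ y : Fin t, star (qft t y j) / (Real.sqrt ((t : ℕ) : ℝ) : ℂ) =
      Complex.exp (Complex.I * ((-(2 * Real.pi * (j : ℕ) / t) : ℝ) : ℂ)) ^ (y : ℕ) / (t : ℕ) := by
    intro y
    simp only [qft, Matrix.of_apply, star_div₀, RCLike.star_def, Complex.conj_ofReal,
      ← Complex.exp_conj]
    rw [div_div, hsq, ← Complex.exp_nat_mul]
    congr 2
    simp only [map_div₀, map_mul, Complex.conj_ofReal, Complex.conj_I, map_natCast, map_ofNat]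
    push_cast
    ring
  simp only [Matrix.mulVec, dotProduct, Fintype.sum_prod_type, Matrix.kronecker_apply,
    Matrix.one_apply, ite_mul, one_mul, zero_mul, Matrix.conjTranspose_apply]
  rw [Finset.sum_eq_single i (by intro b _ hb; simp [Ne.symm hb]) (by simp)]
  simp only [if_true]
  rw [← Fin.sum_univ_eq_sum_range (fun y => Complex.exp (Complex.I *
      ((-(2 * Real.pi * (j : ℕ) / t) : ℝ) : ℂ)) ^ y * ∑ x, ((reflU ψ * reflV P) ^ y) i x * ψ x),
    Finset.sum_div]
  refine Finset.sum_congr rfl fun y _ => ?_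
  rw [mul_div_right_comm, ← h3]
  ring

/-- The Gram matrix `cos (2(n-m)θ)` of the orbit of `ψ` is the average of those of the scalar orbits
`exp (2iyθ)` and `exp (-2iyθ)`, so the outcome law is the average of the two phase estimation laws.
-/
lemma sum_norm_sq_ampEstState {ψ : ι → ℂ} (hψ : IsState ψ) {P : Matrix ι ι ℂ}
    (hP : IsStarProjection P) {θ : ℝ}
    (hθ : star ψ ⬝ᵥ (P *ᵥ ψ) = ((Real.sin θ ^ 2 : ℝ) : ℂ)) (t : ℕ+) (j : Fin t) :
    ∑ i, ‖ampEstState ψ P t (i, j)‖ ^ 2 =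
      (phaseWeight t θ j + phaseWeight t (-θ) j) / 2 := by
  set x : ℕ → ℂ := fun y =>
    Complex.exp (Complex.I * ((-(2 * Real.pi * (j : ℕ) / t) : ℝ) : ℂ)) ^ y with hx
  have h1 := sum_norm_sq_sum_smul (Finset.range t) (fun y => (reflU ψ * reflV P) ^ y *ᵥ ψ) x _
    (dotProduct_iterate_iterate hψ hP hθ)
  have hw : ∀ θ : ℝ, phaseWeight t θ j = ‖∑ y ∈ Finset.range t,
      x y * Complex.exp (Complex.I * ((2 * y * θ : ℝ) : ℂ))‖ ^ 2 / (t : ℕ) ^ 2 := by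
    intro θ
    rw [phaseWeight]
    congr 3
    refine Finset.sum_congr rfl fun y _ => ?_
    simp only [hx]
    rw [← Complex.exp_nat_mul, ← Complex.exp_nat_mul, ← Complex.exp_add]
    congr 1
    push_cast
    ring
  have h2 : ∑ i, ‖ampEstState ψ P t (i, j)‖ ^ 2 = (∑ i, ‖∑ y ∈ Finset.range t,
      x y * ((reflU ψ * reflV P) ^ y *ᵥ ψ) i‖ ^ 2) / (t : ℕ) ^ 2 := by
    rw [Finset.sum_div]
    refine Finset.sum_congr rfl fun i _ => ?_
    rw [ampEstState_apply, norm_div, div_pow, Complex.norm_natCast]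
  rw [h2, hw, hw, ← add_div, div_right_comm]
  congr 1
  rw [← Complex.ofReal_inj, h1, Complex.ofReal_div, Complex.ofReal_add, norm_sq_sum_mul_exp,
    norm_sq_sum_mul_exp, ← Finset.sum_add_distrib, Complex.ofReal_ofNat, Finset.sum_div]
  refine Finset.sum_congr rfl fun m _ => ?_
  rw [← Finset.sum_add_distrib, Finset.sum_div]
  refine Finset.sum_congr rfl fun n _ => ?_
  rw [← mul_add, mul_div_assoc, Complex.ofReal_cos, Complex.cos]
  congr 3
  · rw [mul_comm]
  · congr 1
    push_cast
    ring

/-- Amplitude estimation returns an accurate estimate with probability at least `4/5`. -/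
lemma prob_ampEst_le {ψ : ι → ℂ} (hψ : IsState ψ) {P : Matrix ι ι ℂ}
    (hP : IsStarProjection P) (t : ℕ+) {a : ℝ} (ha0 : 0 ≤ a) (ha1 : a ≤ 1)
    (ha : star ψ ⬝ᵥ (P *ᵥ ψ) = (a : ℂ)) :
    (ampEst ψ hψ P hP t).prob {v | ¬ |v - a| ≤ 400 * (Real.sqrt a / t + 1 / t ^ 2)} ≤
      ENNReal.ofReal (1 / 5) := by
  classical
  set θ := Real.arcsin (Real.sqrt a) with hθ
  have hs : Real.sin θ = Real.sqrt a := Real.sin_arcsin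
    (by linarith [Real.sqrt_nonneg a]) (Real.sqrt_le_one.2 ha1)
  have hs2 : Real.sin θ ^ 2 = a := by rw [hs, Real.sq_sqrt ha0]
  have habs : |Real.sin θ| = Real.sqrt a := by rw [hs, abs_of_nonneg (Real.sqrt_nonneg a)]
  rw [← hs2] at ha
  set S : Finset (Fin t) := Finset.univ.filter fun j =>
    ¬ |Real.sin (Real.pi * (j : ℕ) / t) ^ 2 - a| ≤ 400 * (Real.sqrt a / t + 1 / t ^ 2) with hS
  have hprob : (ampEst ψ hψ P hP t).prob
      {v | ¬ |v - a| ≤ 400 * (Real.sqrt a / t + 1 / t ^ 2)} =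
      ENNReal.ofReal (∑ j ∈ S, ∑ i, ‖ampEstState ψ P t (i, j)‖ ^ 2) := by
    rw [Proc.prob, ampEst, PMF.toOuterMeasure_map_apply, PMF.toOuterMeasure_apply_fintype,
      Fintype.sum_prod_type_right, hS, Finset.sum_filter,
      ENNReal.ofReal_sum_of_nonneg (fun j _ => by split_ifs <;> positivity)]
    refine Finset.sum_congr rfl fun j _ => ?_
    by_cases h : ¬ |Real.sin (Real.pi * (j : ℕ) / t) ^ 2 - a| ≤
        400 * (Real.sqrt a / t + 1 / t ^ 2)
    · rw [if_pos h, ENNReal.ofReal_sum_of_nonneg (fun i _ => by positivity)]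
      refine Finset.sum_congr rfl fun i _ => ?_
      exact Set.indicator_of_mem h _
    · rw [if_neg h, ENNReal.ofReal_zero]
      refine Finset.sum_eq_zero fun i _ => ?_
      exact Set.indicator_of_notMem h _
  rw [hprob]
  refine ENNReal.ofReal_le_ofReal ?_
  simp only [sum_norm_sq_ampEstState hψ hP ha]
  rw [← Finset.sum_div, Finset.sum_add_distrib]
  -- Since `sin²` is even, `θ` and `-θ` have the same bad outcomes, and the tail bound applies to
  -- both.
  have h1 := sum_phaseWeight_le t θ S fun j hj => by
    rw [hs2, habs]
    exact (Finset.mem_filter.1 hj).2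
  have h2 := sum_phaseWeight_le t (-θ) S fun j hj => by
    rw [Real.sin_neg, neg_sq, abs_neg, hs2, habs]
    exact (Finset.mem_filter.1 hj).2
  linarith

end

/-! ### Expectations -/

namespace QAlg

/-- The expectation of `g (v(A))`. -/
noncomputable def expect (A : QAlg) (g : ℝ → ℝ) : ℝ := ∑ x, (A.outcome x).toReal * g (A.φ x)

variable (A : QAlg) (g g' : ℝ → ℝ)

lemma expect_post (f : ℝ → ℝ) : (A.post f).expect g = A.expect fun v => g (f v) := rfl

lemma sum_outcome : ∑ x, (A.outcome x).toReal = 1 := by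
  rw [← ENNReal.toReal_sum (fun x _ => A.outcome.apply_ne_top x), ← tsum_fintype (L := .unconditional _),
    A.outcome.tsum_coe, ENNReal.toReal_one]

lemma expect_const (c : ℝ) : A.expect (fun _ => c) = c := by
  rw [expect, ← Finset.sum_mul, sum_outcome, one_mul]

lemma expect_add : A.expect (fun v => g v + g' v) = A.expect g + A.expect g' := by
  simp only [expect, mul_add, Finset.sum_add_distrib]

lemma expect_sub : A.expect (fun v => g v - g' v) = A.expect g - A.expect g' := by
  simp only [expect, mul_sub, Finset.sum_sub_distrib]

lemma expect_const_mul (c : ℝ) : A.expect (fun v => c * g v) = c * A.expect g := by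
  simp only [expect, Finset.mul_sum]
  exact Finset.sum_congr rfl fun x _ => by ring

lemma expect_sum {κ : Type} (s : Finset κ) (g : κ → ℝ → ℝ) :
    A.expect (fun v => ∑ k ∈ s, g k v) = ∑ k ∈ s, A.expect (g k) := by
  simp only [expect, Finset.mul_sum]
  exact Finset.sum_comm

variable {A g g'}

lemma expect_mono (h : ∀ v, g v ≤ g' v) : A.expect g ≤ A.expect g' :=
  Finset.sum_le_sum fun _ _ => mul_le_mul_of_nonneg_left (h _) ENNReal.toReal_nonneg

lemma expect_nonneg (h : ∀ v, 0 ≤ g v) : 0 ≤ A.expect g :=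
  Finset.sum_nonneg fun _ _ => mul_nonneg ENNReal.toReal_nonneg (h _)

lemma expect_le_one (h : ∀ v, g v ≤ 1) : A.expect g ≤ 1 :=
  (expect_mono h).trans (A.expect_const 1).le

lemma outcome_toReal (A : QAlg) (x : Bits A.k) :
    (A.outcome x).toReal = ∑ i, ‖A.state (i, x)‖ ^ 2 := by
  classical
  rw [outcome, PMF.map_apply, tsum_fintype (L := .unconditional _), Fintype.sum_prod_type_right,
    Finset.sum_eq_single x]
  · rw [ENNReal.toReal_sum]
    · refine Finset.sum_congr rfl fun i _ => ?_
      rw [if_pos rfl]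
      exact ENNReal.toReal_ofReal (by positivity)
    · intro i _
      rw [if_pos rfl]
      exact ENNReal.ofReal_ne_top
  · intro y _ hy
    exact Finset.sum_eq_zero fun i _ => if_neg (Ne.symm hy)
  · simp

lemma law_toReal (A : QAlg) (v : ℝ) :
    (A.law v).toReal = ∑ x with A.φ x = v, (A.outcome x).toReal := by
  classical
  rw [law, PMF.map_apply, tsum_fintype (L := .unconditional _), ENNReal.toReal_sum, Finset.sum_filter]
  · refine Finset.sum_congr rfl fun x _ => ?_
    simp only [eq_comm (a := v)]
    split_ifs <;> simp
  · intro x _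
    split_ifs
    · exact A.outcome.apply_ne_top x
    · exact ENNReal.zero_ne_top

/-- Two algorithms may have different outcome spaces; rewriting expectations over a common finite
set of values makes them comparable. -/
lemma expect_eq_sum_law (A : QAlg) (g : ℝ → ℝ) (S : Finset ℝ) (hS : ∀ x, A.φ x ∈ S) :
    A.expect g = ∑ v ∈ S, (A.law v).toReal * g v := by
  classical
  rw [expect, ← Finset.sum_fiberwise_of_maps_to (t := S) (g := A.φ) (fun x _ => hS x)]
  refine Finset.sum_congr rfl fun v _ => ?_
  rw [law_toReal, Finset.sum_mul]
  refine Finset.sum_congr rfl fun x hx => ?_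
  rw [(Finset.mem_filter.1 hx).2]

lemma prob_run (A : QAlg) (s : Set ℝ) [DecidablePred (· ∈ s)] :
    A.run.prob s = ENNReal.ofReal (A.expect fun v => if v ∈ s then 1 else 0) := by
  classical
  rw [Proc.prob, run, law, PMF.toOuterMeasure_map_apply, PMF.toOuterMeasure_map_apply,
    PMF.toOuterMeasure_apply_fintype, expect, ENNReal.ofReal_sum_of_nonneg
      (fun x _ => mul_nonneg ENNReal.toReal_nonneg (by positivity))]
  refine Finset.sum_congr rfl fun x _ => ?_
  by_cases h : A.φ x ∈ s
  · rw [if_pos h, mul_one, ENNReal.ofReal_toReal (A.outcome.apply_ne_top x)]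
    exact Set.indicator_of_mem (s := A.φ ⁻¹' ((fun v => (v, 0)) ⁻¹' {z | z.1 ∈ s})) h _
  · rw [if_neg h, mul_zero, ENNReal.ofReal_zero]
    exact Set.indicator_of_notMem (s := A.φ ⁻¹' ((fun v => (v, 0)) ⁻¹' {z | z.1 ∈ s})) h _

/-- The expectations of functions with values in `[0,1]` differ by at most `η`. -/
def Close (A B : QAlg) (η : ℝ) : Prop :=
  ∀ g : ℝ → ℝ, (∀ v, 0 ≤ g v ∧ g v ≤ 1) → |A.expect g - B.expect g| ≤ η

lemma Close.post {A B : QAlg} {η : ℝ} (h : A.Close B η) (f : ℝ → ℝ) :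
    (A.post f).Close (B.post f) η := fun g hg => h (fun v => g (f v)) fun _ => hg _

lemma Close.mono {A B : QAlg} {η η' : ℝ} (h : A.Close B η) (hη : η ≤ η') : A.Close B η' :=
  fun g hg => (h g hg).trans hη

end QAlg

lemma tvDist_nonneg (p q : PMF ℝ) : 0 ≤ tvDist p q :=
  mul_nonneg (by norm_num) (tsum_nonneg fun _ => abs_nonneg _)

/-- The plain `ℓ¹` bound loses a factor `2` against the optimal constant `γ`, which the later
tolerance `2/t²` absorbs. -/
lemma QAlg.close_of_tvDist_le {A B : QAlg} {γ : ℝ} (h : tvDist A.law B.law ≤ γ) :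
    A.Close B (2 * γ) := by
  classical
  intro g hg
  set S : Finset ℝ := Finset.univ.image A.φ ∪ Finset.univ.image B.φ with hS
  have hsum : Summable fun v => |(A.law v).toReal - (B.law v).toReal| :=
    ((ENNReal.summable_toReal A.law.tsum_coe_ne_top).sub
      (ENNReal.summable_toReal B.law.tsum_coe_ne_top)).abs
  rw [A.expect_eq_sum_law g S (fun x => by simp [hS]),
    B.expect_eq_sum_law g S (fun x => by simp [hS]), ← Finset.sum_sub_distrib]
  calc |∑ v ∈ S, ((A.law v).toReal * g v - (B.law v).toReal * g v)|
      ≤ ∑ v ∈ S, |(A.law v).toReal * g v - (B.law v).toReal * g v| := Finset.abs_sum_le_sum_abs _ _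
    _ ≤ ∑ v ∈ S, |(A.law v).toReal - (B.law v).toReal| := by
        refine Finset.sum_le_sum fun v _ => ?_
        rw [← sub_mul, abs_mul, abs_of_nonneg (hg v).1]
        exact mul_le_of_le_one_right (abs_nonneg _) (hg v).2
    _ ≤ ∑' v, |(A.law v).toReal - (B.law v).toReal| :=
        hsum.sum_le_tsum S fun _ _ => abs_nonneg _
    _ = 2 * tvDist A.law B.law := by rw [tvDist]; ring
    _ ≤ 2 * γ := by linarith

/-! ### Mean estimation for output values in `[0,1]` -/

lemma flagState_apply (A : QAlg) (i : Bits A.m) (x : Bits A.k) (b : Bool) :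
    flagState A (i, (x, b)) = rot (A.φ x) b false * A.state (i, x) := by
  have h : (Matrix.reindex (Equiv.prodAssoc _ _ _) (Equiv.prodAssoc _ _ _)
      ((A.unitary : Matrix _ _ ℂ) ⊗ₖ (1 : Matrix Bool Bool ℂ))) *ᵥ
      ket (zeroBits A.m, (zeroBits A.k, false)) =
      fun z => if z.2.2 = false then A.state (z.1, z.2.1) else 0 := by
    ext ⟨i, x, b⟩
    simp [ket, QAlg.state, Matrix.one_apply]
  rw [flagState, ← Matrix.mulVec_mulVec, h]
  simp [Matrix.mulVec, dotProduct, Fintype.sum_prod_type, Matrix.one_apply, rotW]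

lemma dotProduct_flagProj_flagState {A : QAlg} (hA : A.Bounded) :
    star (flagState A) ⬝ᵥ (flagProj A *ᵥ flagState A) = ((A.expect id : ℝ) : ℂ) := by
  have h : flagProj A *ᵥ flagState A = fun z => if z.2.2 then flagState A z else 0 := by
    ext z
    simp [flagProj, Matrix.mulVec_diagonal]
  rw [h, QAlg.expect]
  simp only [dotProduct, Fintype.sum_prod_type, Fintype.sum_bool, if_true, Pi.star_apply]
  rw [Finset.sum_comm, Complex.ofReal_sum]
  refine Finset.sum_congr rfl fun x _ => ?_
  rw [QAlg.outcome_toReal, Finset.sum_mul, Complex.ofReal_sum]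
  refine Finset.sum_congr rfl fun i _ => ?_
  have h1 : ((Real.sqrt (A.φ x) : ℂ)) * (Real.sqrt (A.φ x) : ℂ) = (A.φ x : ℂ) := by
    rw [← Complex.ofReal_mul, Real.mul_self_sqrt (hA x).1]
  have h2 : star (A.state (i, x)) * A.state (i, x) = ((‖A.state (i, x)‖ ^ 2 : ℝ) : ℂ) := by
    rw [RCLike.star_def, ← Complex.normSq_eq_conj_mul_self, Complex.normSq_eq_norm_sq]
  rw [flagState_apply, Complex.ofReal_mul, ← h2, id, ← h1]
  simp [rot]
  ring

lemma prob_meanBounded_le {K δ : ℝ} (hK : 10 ≤ K) (hδ : 0 < δ) (hδ1 : δ ≤ 1) (A : QAlg)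
    (hA : A.Bounded) (t : ℕ+) :
    (meanBounded K A hA t δ).prob {v | ¬ |v - A.expect id| ≤
      400 * (Real.sqrt (A.expect id) / t + 1 / t ^ 2)} ≤ ENNReal.ofReal (δ ^ 2) := by
  refine Proc.prob_power_le hK hδ hδ1 ?_
  refine prob_ampEst_le (isState_flagState hA) (isStarProjection_flagProj A) t ?_ ?_
    (dotProduct_flagProj_flagState hA)
  · exact Finset.sum_nonneg fun x _ => mul_nonneg ENNReal.toReal_nonneg (hA x).1
  · rw [← A.sum_outcome]
    exact Finset.sum_le_sum fun x _ => mul_le_of_le_one_right ENNReal.toReal_nonneg (hA x).2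

/-- From `a ≤ b + 2/t² ≤ (√b + 2/t)²` one gets `√a/t ≤ √b/t + 2/t²`. The total coefficient of `1/t²`
is then `400 * 3 + 2 ≤ 1600`. -/
lemma sqrt_transfer {a b t : ℝ} (ht : 0 < t) (hab : |a - b| ≤ 2 / t ^ 2) (v : ℝ)
    (hv : |v - a| ≤ 400 * (Real.sqrt a / t + 1 / t ^ 2)) :
    |v - b| ≤ 1600 * (Real.sqrt b / t + 1 / t ^ 2) := by
  have h1 : Real.sqrt a ≤ Real.sqrt b + 2 / t := by
    have h0 : a ≤ b + (2 / t) ^ 2 := by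
      have := le_of_abs_le hab
      have h2 : 2 / t ^ 2 ≤ (2 / t) ^ 2 := by
        rw [div_pow]
        gcongr
        norm_num
      linarith
    have h3 : b ≤ Real.sqrt b ^ 2 := by
      rcases le_total 0 b with h | h
      · rw [Real.sq_sqrt h]
      · exact h.trans (sq_nonneg _)
    have h4 : 0 ≤ Real.sqrt b * (2 / t) := by positivity
    exact Real.sqrt_le_iff.2 ⟨by positivity, by linarith [add_sq (Real.sqrt b) (2 / t)]⟩
  have h2 : Real.sqrt a / t ≤ Real.sqrt b / t + 2 / t ^ 2 := by
    calc Real.sqrt a / t ≤ (Real.sqrt b + 2 / t) / t := by gcongr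
      _ = _ := by field_simp
  have h3 : 0 ≤ Real.sqrt b / t := by positivity
  have h4 : 0 ≤ 1 / t ^ 2 := by positivity
  have h5 : 2 / t ^ 2 = 2 * (1 / t ^ 2) := by ring
  have h6 := abs_sub_le v a b
  rw [h5] at hab h2
  linarith

/-- Mean estimation applied to an algorithm estimates the mean of a close algorithm. -/
lemma prob_meanBounded_post_le {K δ : ℝ} (hK : 10 ≤ K) (hδ : 0 < δ) (hδ1 : δ ≤ 1) {A B : QAlg}
    {t : ℕ+} (hAB : A.Close B (2 / (t : ℕ) ^ 2)) {f : ℝ → ℝ} (hf : ∀ v, 0 ≤ f v ∧ f v ≤ 1)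
    (hA : (A.post f).Bounded) :
    (meanBounded K (A.post f) hA t δ).prob {v | ¬ |v - B.expect f| ≤
      1600 * (Real.sqrt (B.expect f) / t + 1 / t ^ 2)} ≤ ENNReal.ofReal (δ ^ 2) := by
  refine le_trans (Proc.prob_mono _ ?_) (prob_meanBounded_le hK hδ hδ1 (A.post f) hA t)
  intro v hv hv'
  have ht : (0 : ℝ) < (t : ℕ) := by exact_mod_cast t.pos
  exact hv (sqrt_transfer ht (hAB f hf) v hv')

lemma usesAtLeast_meanBounded (K δ : ℝ) (A : QAlg) (hA : A.Bounded) (t : ℕ+) :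
    (meanBounded K A hA t δ).UsesAtLeast t := by
  refine Proc.UsesAtLeast.power ?_ K δ
  intro z hz
  rw [ampEst, PMF.mem_support_map_iff] at hz
  obtain ⟨_, -, rfl⟩ := hz
  exact le_rfl

/-! ### Dyadic decomposition -/

lemma trunc_nonneg {p : ℝ} (hp : 0 ≤ p) (q v : ℝ) : 0 ≤ trunc p q v := by
  rw [trunc]
  split_ifs with h
  · exact hp.trans h.1
  · exact le_rfl

lemma trunc_le {v : ℝ} (hv : 0 ≤ v) (p q : ℝ) : trunc p q v ≤ v := by
  rw [trunc]
  split_ifs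
  · exact le_rfl
  · exact hv

lemma trunc_le_right {q : ℝ} (hq : 0 ≤ q) (p v : ℝ) : trunc p q v ≤ q := by
  rw [trunc]
  split_ifs with h
  · exact h.2.le
  · exact hq

lemma trunc_add_trunc {p q r : ℝ} (hpq : p ≤ q) (hqr : q ≤ r) (v : ℝ) :
    trunc p q v + trunc q r v = trunc p r v := by
  simp only [trunc]
  rcases lt_or_ge v q with h | h
  · simp [h, h.not_ge, h.trans_le hqr]
  · simp [h, h.not_gt, hpq.trans h]

lemma trunc_add_sum (k : ℕ) (v : ℝ) :
    trunc 0 1 v + ∑ l ∈ Finset.range k, trunc (2 ^ l) (2 ^ (l + 1)) v = trunc 0 (2 ^ k) v := by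
  induction k with
  | zero => simp
  | succ k ih =>
    rw [Finset.sum_range_succ, ← add_assoc, ih, trunc_add_trunc (by positivity)]
    exact pow_le_pow_right₀ one_le_two (Nat.le_succ k)

lemma sub_trunc_le {q v : ℝ} (hq : 0 < q) (hv : 0 ≤ v) : v - trunc 0 q v ≤ 1 / q * v ^ 2 := by
  rw [trunc]
  split_ifs with h
  · rw [sub_self]
    positivity
  · have : q ≤ v := not_lt.1 fun h' => h ⟨hv, h'⟩
    rw [sub_zero, one_div, inv_mul_eq_div, le_div_iff₀ hq]
    nlinarith

/-- The function whose mean is estimated on the `l`-th dyadic level. -/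
noncomputable def level (l : ℕ) (v : ℝ) : ℝ := trunc (2 ^ l) (2 ^ (l + 1)) v / 2 ^ (l + 1)

lemma level_mem (l : ℕ) (v : ℝ) : 0 ≤ level l v ∧ level l v ≤ 1 :=
  ⟨div_nonneg (trunc_nonneg (by positivity) _ _) (by positivity),
    (div_le_one (by positivity)).2 (trunc_le_right (by positivity) _ _)⟩

lemma pow_mul_level (l : ℕ) (v : ℝ) :
    2 ^ (l + 1) * level l v = trunc (2 ^ l) (2 ^ (l + 1)) v :=
  mul_div_cancel₀ _ (by positivity)

/-- On its level `2^(l+1) ≤ 2v`, so each term is at most `2v` times the truncation; the levels are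
disjoint and the truncations add up to at most `v`. -/
lemma sum_sq_mul_level_le (k : ℕ) {v : ℝ} (hv : 0 ≤ v) :
    ∑ l ∈ Finset.range k, (2 ^ (l + 1)) ^ 2 * level l v ≤ 2 * v ^ 2 := by
  have h1 : ∀ l, (2 ^ (l + 1)) ^ 2 * level l v ≤ 2 * v * trunc (2 ^ l) (2 ^ (l + 1)) v := by
    intro l
    rw [pow_two ((2 : ℝ) ^ (l + 1)), mul_assoc, pow_mul_level, trunc]
    split_ifs with h
    · refine mul_le_mul_of_nonneg_right ?_ hv
      rw [pow_succ]
      linarith [h.1]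
    · simp
  calc ∑ l ∈ Finset.range k, (2 ^ (l + 1)) ^ 2 * level l v
      ≤ ∑ l ∈ Finset.range k, 2 * v * trunc (2 ^ l) (2 ^ (l + 1)) v :=
        Finset.sum_le_sum fun l _ => h1 l
    _ = 2 * v * (trunc 0 (2 ^ k) v - trunc 0 1 v) := by
        rw [← Finset.mul_sum, ← trunc_add_sum k v, add_sub_cancel_left]
    _ ≤ 2 * v * v := by
        refine mul_le_mul_of_nonneg_left ?_ (by positivity)
        linarith [trunc_le hv 0 (2 ^ k), trunc_nonneg (le_refl (0 : ℝ)) 1 v]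
    _ = 2 * v ^ 2 := by ring

/-! ### Mean estimation for non-negative output values -/

lemma prob_levels_le {K δ : ℝ} (hK : 10 ≤ K) (hδ : 0 < δ) (hδ1 : δ ≤ 1) {A B : QAlg} {t : ℕ+}
    (hAB : A.Close B (2 / (t : ℕ) ^ 2)) (k : ℕ) :
    (levels K A t δ k).prob {s | ¬ |s - ∑ l ∈ Finset.range k, 2 ^ (l + 1) * B.expect (level l)| ≤
      ∑ l ∈ Finset.range k, 2 ^ (l + 1) *
        (1600 * (Real.sqrt (B.expect (level l)) / t + 1 / t ^ 2))} ≤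
      ENNReal.ofReal (k * δ ^ 2) := by
  induction k with
  | zero =>
    refine (Proc.prob_pure ?_).trans_le zero_le
    simp
  | succ k ih =>
    rw [levels]
    have hb := prob_meanBounded_post_le hK hδ hδ1 hAB (level_mem k) (bounded_level A k)
    refine (Proc.prob_bind_le_add _ _ _ _ fun s hs => (Proc.prob_map_le _ _ _ _ ?_).trans hb).trans
      ((add_le_add_left ih _).trans ?_)
    · intro μ hμ hsμ
      simp only [Set.mem_ofPred_eq, not_not] at hs hμ hsμ
      refine hsμ ?_
      rw [Finset.sum_range_succ, Finset.sum_range_succ]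
      have h2 : (0 : ℝ) < 2 ^ (k + 1) := by positivity
      have h1 : |(2 : ℝ) ^ (k + 1) * (μ - B.expect (level k))| ≤ 2 ^ (k + 1) *
          (1600 * (Real.sqrt (B.expect (level k)) / t + 1 / t ^ 2)) := by
        rw [abs_mul, abs_of_pos h2]
        exact mul_le_mul_of_nonneg_left hμ h2.le
      refine le_trans (le_of_eq ?_) ((abs_add_le _ _).trans (add_le_add hs h1))
      congr 1
      ring
    · rw [← ENNReal.ofReal_add (by positivity) (by positivity)]
      refine ENNReal.ofReal_le_ofReal (le_of_eq ?_)
      push_cast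
      ring

lemma prob_truncated_le {K : ℝ} (hK : 10 ≤ K) {A B : QAlg} {t : ℕ+}
    (hAB : A.Close B (2 / (t : ℕ) ^ 2)) {k : ℕ} (hk : 1 ≤ k) :
    (do
      let μ₀ ← meanBounded K (A.post (trunc 0 1)) (bounded_trunc A) t (1 / 10)
      let s ← levels K A t (1 / (10 * k)) k
      pure (μ₀ + s) : Proc ℝ).prob
      {v | ¬ |v - (B.expect (trunc 0 1) +
          ∑ l ∈ Finset.range k, 2 ^ (l + 1) * B.expect (level l))| ≤
        1600 * (Real.sqrt (B.expect (trunc 0 1)) / t + 1 / t ^ 2) +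
        ∑ l ∈ Finset.range k, 2 ^ (l + 1) *
          (1600 * (Real.sqrt (B.expect (level l)) / t + 1 / t ^ 2))} ≤ ENNReal.ofReal (1 / 5) := by
  have hk' : (1 : ℝ) ≤ k := by exact_mod_cast hk
  have hb := prob_meanBounded_post_le hK (δ := 1 / 10) (by norm_num) (by norm_num) hAB
    (f := trunc 0 1) (fun v => ⟨trunc_nonneg le_rfl _ _, trunc_le_right zero_le_one _ _⟩)
    (bounded_trunc A)
  have hl := prob_levels_le hK (δ := 1 / (10 * k)) (by positivity)
    (by rw [div_le_one (by positivity)]; linarith) hAB k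
  refine (Proc.prob_bind_le_add _ _ _ _ fun s hs => (Proc.prob_map_le _ _ _ _ ?_).trans hl).trans
    ((add_le_add_left hb _).trans ?_)
  · intro μ hμ hsμ
    simp only [Set.mem_ofPred_eq, not_not] at hs hμ hsμ
    refine hsμ (le_trans (le_of_eq ?_) ((abs_add_le _ _).trans (add_le_add hs hμ)))
    congr 1
    ring
  · rw [← ENNReal.ofReal_add (by positivity) (by positivity)]
    refine ENNReal.ofReal_le_ofReal ?_
    have : (k : ℝ) * (1 / (10 * k)) ^ 2 ≤ 1 / 100 := by
      rw [show (k : ℝ) * (1 / (10 * k)) ^ 2 = 1 / (100 * k) by field_simp; norm_num]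
      gcongr
      linarith
    linarith

lemma le_logb_of_lt {ε : ℝ} (hε : 0 < ε) (hε1 : ε < 1 / 8) : 1 ≤ Real.logb 2 (1 / ε) := by
  rw [Real.le_logb_iff_rpow_le one_lt_two (by positivity), Real.rpow_one, le_div_iff₀ hε]
  linarith

lemma truncated_error_le {D ε t : ℝ} {k : ℕ} (hD : 20000 ≤ D) (hε : 0 < ε) (hε1 : ε < 1 / 8)
    (hk : (k : ℝ) ≤ Real.logb 2 (1 / ε) + 1)
    (ht : D * Real.sqrt (Real.logb 2 (1 / ε)) / ε ≤ t) {b₀ : ℝ} (hb₀ : b₀ ≤ 1) {b : ℕ → ℝ}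
    (hb0 : ∀ l, 0 ≤ b l) (hb : ∑ l ∈ Finset.range k, (2 ^ (l + 1)) ^ 2 * b l ≤ 2) :
    1600 * (Real.sqrt b₀ / t + 1 / t ^ 2) + ∑ l ∈ Finset.range k, 2 ^ (l + 1) *
      (1600 * (Real.sqrt (b l) / t + 1 / t ^ 2)) ≤ ε := by
  set L := Real.logb 2 (1 / ε) with hL
  have hL1 : 1 ≤ L := le_logb_of_lt hε hε1
  have hsL : 1 ≤ Real.sqrt L := Real.one_le_sqrt.2 hL1
  have hD0 : 0 < D := by linarith
  have ht0 : 0 < t := lt_of_lt_of_le (by positivity) ht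
  -- Cauchy–Schwarz over the `k` levels, with `2k ≤ 4L` because `k ≤ L + 1` and `L ≥ 1`. This is the
  -- origin of the factor `√(log (1/ε))` in the number of iterations.
  have hX : ∑ l ∈ Finset.range k, 2 ^ (l + 1) * Real.sqrt (b l) ≤ 2 * Real.sqrt L := by
    have h1 := sq_sum_le_card_mul_sum_sq (s := Finset.range k)
      (f := fun l => 2 ^ (l + 1) * Real.sqrt (b l))
    simp only [mul_pow _ (Real.sqrt _), Real.sq_sqrt (hb0 _), Finset.card_range] at h1
    refine abs_le_of_sq_le_sq' ?_ (by positivity) |>.2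
    rw [mul_pow, Real.sq_sqrt (by linarith)]
    have h2 : (k : ℝ) * ∑ l ∈ Finset.range k, (2 ^ (l + 1)) ^ 2 * b l ≤ k * 2 :=
      mul_le_mul_of_nonneg_left hb (Nat.cast_nonneg k)
    linarith
  have hpow : (2 : ℝ) ^ k ≤ 2 / ε := by
    rw [← Real.rpow_natCast]
    refine (Real.rpow_le_rpow_of_exponent_le one_le_two hk).trans (le_of_eq ?_)
    rw [Real.rpow_add two_pos, Real.rpow_logb two_pos (by norm_num) (by positivity), Real.rpow_one]
    ring
  have hgeom : ∑ l ∈ Finset.range k, (2 : ℝ) ^ (l + 1) ≤ 4 / ε - 2 := by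
    have h1 := geom_sum_mul (2 : ℝ) k
    simp only [pow_succ, ← Finset.sum_mul]
    have h2 : 4 / ε = 2 * (2 / ε) := by ring
    linarith
  have h1 : Real.sqrt L / t ≤ ε / D := by
    rw [div_le_div_iff₀ ht0 hD0]
    rw [div_le_iff₀ hε] at ht
    linarith
  have h2 : 1 / t ^ 2 ≤ ε ^ 2 / D := by
    have h3 : 1 / t ≤ ε / D := le_trans (by gcongr) h1
    calc 1 / t ^ 2 = (1 / t) ^ 2 := by rw [div_pow, one_pow]
      _ ≤ (ε / D) ^ 2 := by gcongr
      _ = ε ^ 2 / D ^ 2 := by rw [div_pow]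
      _ ≤ ε ^ 2 / D := by
        gcongr
        exact le_self_pow₀ (by linarith) two_ne_zero
  have hsb : Real.sqrt b₀ ≤ Real.sqrt L := Real.sqrt_le_sqrt (hb₀.trans hL1)
  calc _ = 1600 * ((Real.sqrt b₀ + ∑ l ∈ Finset.range k, 2 ^ (l + 1) * Real.sqrt (b l)) / t +
        (1 + ∑ l ∈ Finset.range k, (2 : ℝ) ^ (l + 1)) * (1 / t ^ 2)) := by
        have : ∀ l : ℕ, (2 : ℝ) ^ (l + 1) * (1600 * (Real.sqrt (b l) / t + 1 / t ^ 2)) =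
            1600 / t * (2 ^ (l + 1) * Real.sqrt (b l)) + 1600 / t ^ 2 * 2 ^ (l + 1) := by
          intro l
          ring
        simp only [this, Finset.sum_add_distrib, ← Finset.mul_sum]
        ring
    -- The `-2` in `hgeom` absorbs the `1` from the bottom level. Both contributions become
    -- multiples of `ε/D`, in total `1600 * 7 = 11200`, below `D`.
    _ ≤ 1600 * (3 * Real.sqrt L / t + 4 / ε * (ε ^ 2 / D)) := by
        gcongr
        · linarith
        · linarith
    _ = 1600 * (3 * (Real.sqrt L / t) + 4 * (ε / D)) := by
        field_simp
    _ ≤ 1600 * (3 * (ε / D) + 4 * (ε / D)) := by gcongr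
    _ = 11200 / D * ε := by ring
    _ ≤ 1 * ε := by
        gcongr
        rw [div_le_one hD0]
        linarith
    _ = ε := one_mul ε

/-- The parameter of the amplitude estimations made by `meanL2`. -/
noncomputable def iterations (D ε : ℝ) : ℕ+ :=
  ⌈D * Real.sqrt (Real.logb 2 (1 / ε)) / ε⌉₊.toPNat'

lemma le_iterations (D ε : ℝ) :
    D * Real.sqrt (Real.logb 2 (1 / ε)) / ε ≤ ((iterations D ε : ℕ) : ℝ) := by
  refine (Nat.le_ceil _).trans ?_
  rw [iterations, Nat.toPNat'_coe]
  -- `Nat.toPNat'` sends `0` to `1`, so the lower bound also survives a vanishing ceiling.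
  split_ifs with h
  · exact le_rfl
  · rw [Nat.eq_zero_of_not_pos h]
    norm_num

/-- Mean estimation for non-negative output values, applied to an algorithm `A`, estimates the mean
of a close algorithm `B` with bounded second moment. -/
lemma prob_meanL2_le {D K ε : ℝ} (hD : 20000 ≤ D) (hK : 10 ≤ K) (hε : 0 < ε) (hε1 : ε < 1 / 8)
    {A B : QAlg} (hAB : A.Close B (2 / (iterations D ε : ℕ) ^ 2)) {f : ℝ → ℝ} (hf : ∀ v, 0 ≤ f v)
    (hB : B.expect (fun v => f v ^ 2) ≤ 1) :
    (meanL2 D K (A.post f) ε).prob {v | ¬ |v - B.expect f| ≤ 2 * ε} ≤ ENNReal.ofReal (1 / 5) := by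
  set k := ⌈Real.logb 2 (1 / ε)⌉₊ with hk
  have hL := le_logb_of_lt hε hε1
  have hkL : (k : ℝ) ≤ Real.logb 2 (1 / ε) + 1 := (Nat.ceil_lt_add_one (by linarith)).le
  have hk1 : 1 ≤ k := Nat.one_le_ceil_iff.2 (by linarith)
  have h1 := prob_truncated_le hK (hAB.post f) hk1
  refine le_trans (Proc.prob_mono _ ?_) h1
  have hb : ∑ l ∈ Finset.range k, (2 ^ (l + 1)) ^ 2 * (B.post f).expect (level l) ≤ 2 := by
    simp only [← QAlg.expect_const_mul, ← QAlg.expect_sum, QAlg.expect_post]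
    calc _ ≤ B.expect fun v => 2 * f v ^ 2 :=
          QAlg.expect_mono fun v => sum_sq_mul_level_le k (hf v)
      _ ≤ 2 := by rw [QAlg.expect_const_mul]; linarith
  have herr := truncated_error_le hD hε hε1 hkL (le_iterations D ε)
    (b₀ := (B.post f).expect (trunc 0 1)) (b := fun l => (B.post f).expect (level l))
    (QAlg.expect_le_one fun v => trunc_le_right zero_le_one _ _)
    (fun l => QAlg.expect_nonneg fun v => (level_mem l v).1) hb
  have htrunc : (B.post f).expect (trunc 0 1) +
      ∑ l ∈ Finset.range k, 2 ^ (l + 1) * (B.post f).expect (level l) =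
      B.expect fun v => trunc 0 (2 ^ k) (f v) := by
    simp only [← QAlg.expect_const_mul, ← QAlg.expect_sum, QAlg.expect_post, ← QAlg.expect_add,
      pow_mul_level, trunc_add_sum]
  have hpow : 1 / (2 : ℝ) ^ k ≤ ε := by
    rw [div_le_iff₀ (by positivity), ← div_le_iff₀' hε, ← Real.rpow_natCast,
      ← Real.logb_le_iff_le_rpow one_lt_two (by positivity)]
    exact Nat.le_ceil _
  have hlow : (B.expect fun v => trunc 0 (2 ^ k) (f v)) ≤ B.expect f :=
    QAlg.expect_mono fun v => trunc_le (hf v) _ _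
  -- Half of the error budget `2ε` is spent on cutting off at `2^k`: above the cut, `f ≤ f²/2^k`,
  -- and `2^k ≥ 1/ε`.
  have hupp : B.expect f - (B.expect fun v => trunc 0 (2 ^ k) (f v)) ≤ ε := by
    rw [← QAlg.expect_sub]
    calc _ ≤ B.expect fun v => 1 / 2 ^ k * f v ^ 2 :=
          QAlg.expect_mono fun v => sub_trunc_le (by positivity) (hf v)
      _ ≤ 1 / 2 ^ k := by
          rw [QAlg.expect_const_mul]
          exact mul_le_of_le_one_right (by positivity) hB
      _ ≤ ε := hpow
  intro v hv hv'
  refine hv ?_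
  have h2 := hv'.trans herr
  rw [htrunc, abs_le] at h2
  rw [abs_le]
  constructor <;> linarith [h2.1, h2.2]

lemma usesAtLeast_meanL2 (D K : ℝ) (A : QAlg) (ε : ℝ) :
    (meanL2 D K A ε).UsesAtLeast (iterations D ε) :=
  (usesAtLeast_meanBounded K (1 / 10) _ (bounded_trunc A) (iterations D ε)).bind_left _

/-! ### Mean estimation for output values with bounded variance -/

/-- The first amplitude estimation alone gives this count. Such a crude bound suffices, as it is
only used to deduce `t ≤ T`. -/
lemma usesAtLeast_meanVariance (D K K' : ℝ) (A : QAlg) (σ ε : ℝ) :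
    (meanVariance D K K' A σ ε).UsesAtLeast (iterations D (ε / (32 * σ))) :=
  Proc.UsesAtLeast.bind_right _ fun _ => ((usesAtLeast_meanL2 D K _ _).power K' (1 / 9)).bind_left _

/-- The negative part, divided by four, of the shifted and rescaled output value. -/
noncomputable def quarterNeg (σ m v : ℝ) : ℝ := -(if v / σ - m < 0 then v / σ - m else 0) / 4

/-- The positive part, divided by four, of the shifted and rescaled output value. -/
noncomputable def quarterPos (σ m v : ℝ) : ℝ := (if 0 ≤ v / σ - m then v / σ - m else 0) / 4

lemma quarterNeg_nonneg (σ m v : ℝ) : 0 ≤ quarterNeg σ m v := by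
  rw [quarterNeg]
  split_ifs with h <;> linarith

lemma quarterPos_nonneg (σ m v : ℝ) : 0 ≤ quarterPos σ m v := by
  rw [quarterPos]
  split_ifs with h <;> linarith

lemma quarterNeg_sq_le (σ m v : ℝ) : quarterNeg σ m v ^ 2 ≤ 1 / 16 * (v / σ - m) ^ 2 := by
  rw [quarterNeg]
  split_ifs with h <;> nlinarith [sq_nonneg (v / σ - m)]

lemma quarterPos_sq_le (σ m v : ℝ) : quarterPos σ m v ^ 2 ≤ 1 / 16 * (v / σ - m) ^ 2 := by
  rw [quarterPos]
  split_ifs with h <;> nlinarith [sq_nonneg (v / σ - m)]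

lemma quarterPos_sub_quarterNeg (σ m v : ℝ) :
    quarterPos σ m v - quarterNeg σ m v = (1 / (4 * σ)) * v - m / 4 := by
  rw [quarterPos, quarterNeg, one_div, mul_inv, mul_assoc, inv_mul_eq_div σ v]
  split_ifs <;> linarith

lemma QAlg.mean_eq (B : QAlg) : B.mean = B.expect fun v => v := rfl

lemma QAlg.variance_eq (B : QAlg) : B.variance = B.expect fun v => (v - B.mean) ^ 2 := rfl

lemma QAlg.expect_sq_le (B : QAlg) {σ m : ℝ} (hσ : 0 < σ) (hB : B.variance ≤ σ ^ 2)
    (hm : |m - B.mean / σ| ≤ 3) : (B.expect fun v => (v / σ - m) ^ 2) ≤ 10 := by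
  have h1 : (fun v => (v / σ - m) ^ 2) = fun v => 1 / σ ^ 2 * (v - B.mean) ^ 2 +
      (2 * (B.mean / σ - m) / σ * (v - B.mean) + (m - B.mean / σ) ^ 2) := by
    ext v
    field_simp
    ring
  have h2 : 1 / σ ^ 2 * B.variance ≤ 1 := by
    rw [one_div, inv_mul_eq_div, div_le_one (by positivity)]
    exact hB
  have h3 : (m - B.mean / σ) ^ 2 ≤ 3 ^ 2 := sq_le_sq' (abs_le.1 hm).1 (abs_le.1 hm).2
  rw [h1, expect_add, expect_add, expect_const_mul, expect_const_mul, expect_sub, expect_const,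
    expect_const, ← mean_eq, ← variance_eq]
  linarith

/-- Chebyshev's inequality. -/
lemma QAlg.expect_far_le (B : QAlg) {σ : ℝ} (hσ : 0 < σ) (hB : B.variance ≤ σ ^ 2)
    [DecidablePred (· ∈ {m : ℝ | ¬ |m - B.mean / σ| ≤ 3})] :
    (B.expect fun v => if v / σ ∈ {m : ℝ | ¬ |m - B.mean / σ| ≤ 3} then 1 else 0) ≤ 1 / 9 := by
  calc _ ≤ B.expect fun v => 1 / (9 * σ ^ 2) * (v - B.mean) ^ 2 := by
        refine expect_mono fun v => ?_
        split_ifs with h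
        · have h1 : 3 < |v / σ - B.mean / σ| := not_le.1 h
          have h2 : 3 ^ 2 ≤ (v / σ - B.mean / σ) ^ 2 := by
            rw [← sq_abs (v / σ - B.mean / σ)]
            gcongr
          calc (1 : ℝ) ≤ 1 / 9 * (v / σ - B.mean / σ) ^ 2 := by linarith
            _ = _ := by field_simp
        · positivity
    _ = 1 / (9 * σ ^ 2) * B.variance := by rw [expect_const_mul, ← variance_eq]
    _ ≤ 1 / (9 * σ ^ 2) * σ ^ 2 := by gcongr
    _ = 1 / 9 := by field_simp

/-- Mean estimation with bounded variance, applied to an algorithm `A`, estimates the mean of a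
close algorithm `B`. -/
lemma prob_meanVariance_le {D K K' σ ε : ℝ} (hD : 20000 ≤ D) (hK : 10 ≤ K) (hK' : 10 ≤ K')
    (hε : 0 < ε) (hεσ : ε < 4 * σ) {A B : QAlg} (hB : B.variance ≤ σ ^ 2)
    (hAB : A.Close B (2 / (iterations D (ε / (32 * σ)) : ℕ) ^ 2)) :
    (meanVariance D K K' A σ ε).prob {v | ¬ |v - B.mean| ≤ ε} ≤ ENNReal.ofReal (3 / 10) := by
  classical
  have hσ : 0 < σ := by linarith
  set ε' := ε / (32 * σ) with hε'
  have hε'0 : 0 < ε' := by positivity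
  have hε'1 : ε' < 1 / 8 := by
    rw [hε', div_lt_iff₀ (by positivity)]
    linarith
  have hσε : σ * ε' = ε / 32 := by
    rw [hε']
    field_simp
  have ht : (20000 : ℝ) ≤ (iterations D ε' : ℕ) := by
    refine le_trans ?_ (le_iterations D ε')
    rw [le_div_iff₀ hε'0]
    have := Real.one_le_sqrt.2 (le_logb_of_lt hε'0 hε'1)
    nlinarith
  -- The initial sample is drawn from `A`, whereas Chebyshev's inequality holds for `B`; closeness
  -- of the two costs at most `1/100`.
  have hη : 2 / ((iterations D ε' : ℕ) : ℝ) ^ 2 ≤ 1 / 100 := by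
    rw [div_le_div_iff₀ (by positivity) (by norm_num)]
    nlinarith
  set far : Set ℝ := {m | ¬ |m - B.mean / σ| ≤ 3} with hfar
  have hrun : (A.post fun v => v / σ).run.prob far ≤ ENNReal.ofReal (1 / 9 + 1 / 100) := by
    rw [QAlg.prob_run, QAlg.expect_post]
    refine ENNReal.ofReal_le_ofReal ?_
    have h1 := le_of_abs_le (hAB (fun v => if v / σ ∈ far then 1 else 0)
      fun v => by split_ifs <;> norm_num)
    have h2 := B.expect_far_le hσ hB
    linarith
  have hpart : ∀ m ∉ far, ∀ f : ℝ → ℝ, (∀ v, 0 ≤ f v) →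
      (∀ v, f v ^ 2 ≤ 1 / 16 * (v / σ - m) ^ 2) →
      ((meanL2 D K (A.post f) ε').power K' (1 / 9)).prob {v | ¬ |v - B.expect f| ≤ 2 * ε'} ≤
        ENNReal.ofReal ((1 / 9) ^ 2) := by
    intro m hm f hf hf2
    refine Proc.prob_power_le hK' (by norm_num) (by norm_num)
      (prob_meanL2_le hD hK hε'0 hε'1 hAB hf ?_)
    -- A sample within `3` of the scaled mean leaves second moment at most `1 + 3² = 10`, and
    -- dividing the values by `4` brings it below `1`.
    have h1 := B.expect_sq_le hσ hB (not_not.1 hm)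
    have h2 : (B.expect fun v => f v ^ 2) ≤ B.expect fun v => 1 / 16 * (v / σ - m) ^ 2 :=
      QAlg.expect_mono hf2
    rw [QAlg.expect_const_mul] at h2
    linarith
  -- Union bound over the sample and the two halves. The nested post-processings of the algorithm
  -- agree by definition with a single one by `quarterNeg σ m` or `quarterPos σ m`.
  refine (Proc.prob_bind_le_add _ _ _ far fun m hm =>
    (Proc.prob_bind_le_add _ _ _ {v | ¬ |v - B.expect (quarterNeg σ m)| ≤ 2 * ε'}
      fun μneg hneg => (Proc.prob_map_le _ _ _ {v | ¬ |v - B.expect (quarterPos σ m)| ≤ 2 * ε'}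
        fun μpos hpos => ?_).trans
      (hpart m hm (quarterPos σ m) (quarterPos_nonneg σ m) (quarterPos_sq_le σ m))).trans
    (add_le_add_left (hpart m hm (quarterNeg σ m) (quarterNeg_nonneg σ m)
      (quarterNeg_sq_le σ m)) _)).trans ((add_le_add_left hrun _).trans ?_)
  · simp only [Set.mem_ofPred_eq, not_not] at hneg hpos ⊢
    have h1 : B.expect (quarterPos σ m) - B.expect (quarterNeg σ m) =
        1 / (4 * σ) * B.mean - m / 4 := by
      rw [← QAlg.expect_sub]
      simp only [quarterPos_sub_quarterNeg]
      rw [QAlg.expect_sub, QAlg.expect_const_mul, QAlg.expect_const, ← QAlg.mean_eq]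
    have h2 : σ * (m - 4 * μneg + 4 * μpos) - B.mean = 4 * σ *
        ((μpos - B.expect (quarterPos σ m)) - (μneg - B.expect (quarterNeg σ m))) := by
      have h3 : 4 * σ * (1 / (4 * σ) * B.mean - m / 4) = B.mean - σ * m := by
        field_simp
      linear_combination 4 * σ * h1 + h3
    rw [h2, abs_mul, abs_of_pos (by positivity : 0 < 4 * σ)]
    have h4 := (abs_sub _ _).trans (add_le_add hpos hneg)
    calc _ ≤ 4 * σ * (2 * ε' + 2 * ε') := by gcongr
      _ = 16 * (σ * ε') := by ring
      _ ≤ ε := by rw [hσε]; linarith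
  -- The failure probabilities add up to `1/9 + 1/100 + 2/81 < 3/10`.
  · rw [← ENNReal.ofReal_add (by positivity) (by positivity),
      ← ENNReal.ofReal_add (by positivity) (by positivity)]
    exact ENNReal.ofReal_le_ofReal (by norm_num)

end QMC

/-! ### Trivial regime against resolution regime -/

theorem mainTheorem9 :
    ∃ D₀ K₀ K₀' : ℝ, ∀ D K K' : ℝ, D₀ ≤ D → K₀ ≤ K → K₀' ≤ K' →
      ∀ (A B : QMC.QAlg) (σ ε γ : ℝ) (T : ℕ), 0 < ε → ε < 4 * σ →
        B.variance ≤ σ ^ 2 →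
        QMC.tvDist A.law B.law ≤ γ →
        (QMC.meanVariance D K K' A σ ε).UsesAtMost T →
        (QMC.meanVariance D K K' A σ ε).prob {v | ¬ |v - B.mean| ≤ ε} ≤
          ENNReal.ofReal (3 / 10 + Real.pi ^ 2 / Real.sqrt 6 * T * Real.sqrt γ) := by
  refine ⟨20000, 10, 10, fun D K K' hD hK hK' A B σ ε γ T hε hεσ hB hγ hT => ?_⟩
  have hγ0 : 0 ≤ γ := (QMC.tvDist_nonneg _ _).trans hγ
  have hc : 1 ≤ Real.pi ^ 2 / Real.sqrt 6 := by
    rw [one_le_div (by positivity), Real.sqrt_le_left (by positivity)]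
    have := Real.pi_gt_three
    have h9 : 9 ≤ Real.pi ^ 2 := by nlinarith
    nlinarith
  have hTγ : 0 ≤ T * Real.sqrt γ := by positivity
  have hle : T * Real.sqrt γ ≤ Real.pi ^ 2 / Real.sqrt 6 * T * Real.sqrt γ := by
    rw [mul_assoc]
    exact le_mul_of_one_le_left hTγ hc
  -- Either the claimed bound exceeds `1`, or `γ` lies below the resolution `1/t²` and the term in
  -- `T√γ` is not needed at all.
  rcases le_or_gt 1 (T * Real.sqrt γ) with h | h
  · refine (QMC.Proc.prob_le_one _ _).trans ?_
    rw [← ENNReal.ofReal_one]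
    exact ENNReal.ofReal_le_ofReal (by linarith)
  · refine (QMC.prob_meanVariance_le hD hK hK' hε hεσ hB
      ((QMC.QAlg.close_of_tvDist_le hγ).mono ?_)).trans
      (ENNReal.ofReal_le_ofReal (by linarith))
    set t := QMC.iterations D (ε / (32 * σ)) with ht
    have htT : (t : ℕ) ≤ T := (QMC.usesAtLeast_meanVariance D K K' A σ ε).le_of_usesAtMost hT
    have ht0 : (0 : ℝ) < (t : ℕ) := by exact_mod_cast t.pos
    have htT' : ((t : ℕ) : ℝ) ≤ T := by exact_mod_cast htT
    have h1 : (t : ℕ) * Real.sqrt γ ≤ 1 :=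
      (mul_le_mul_of_nonneg_right htT' (Real.sqrt_nonneg γ)).trans h.le
    have h2 : ((t : ℕ) * Real.sqrt γ) ^ 2 ≤ 1 := pow_le_one₀ (by positivity) h1
    rw [mul_pow, Real.sq_sqrt hγ0] at h2
    rw [le_div_iff₀ (by positivity)]
    linarith
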